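/- Let $K$ be an integral domain of characteristic $0$ and let $q\in K$ be an invertible element which is a square in $K$ and such that $q+1$ is invertible in $K$. For $x,y$ in a ring put $V(x,y)=xyx+xy+yx+x+y+1$. For $m\ge 2$ let $\widehat{TL}_m(q)$ be the unital associative $K$-algebra generated by $g_{\sigma_1},\dots,g_{\sigma_{m-1}},g_{a_m}$ subject to the relations $g^2=(q-1)g+q$ for each generator $g$ and, if $m\ge 3$, the further relations - $g_{\sigma_i}g_{\sigma_j}=g_{\sigma_j}g_{\sigma_i}$ for $1\le i,j\le m-1$, $|i-j|\ge 2$, and $g_{\sigma_i}g_{a_m}=g_{a_m}g_{\sigma_i}$ for $2\le i\le m-2$; - $g_{\sigma_i}g_{\sigma_{i+1}}g_{\sigma_i}=g_{\sigma_{i+1}}g_{\sigma_i}g_{\sigma_{i+1}}$ for $1\le i\le m-2$, and $g_{\sigma_i}g_{a_m}g_{\sigma_i}=g_{a_m}g_{\sigma_i}g_{a_m}$ for $i\in\{1,m-1\}$; - $V(g_{\sigma_i},g_{\sigma_{i+1}})=0$ for $1\le i\le m-2$, and $V(g_{\sigma_1},g_{a_m})=V(g_{\sigma_{m-1}},g_{a_m})=0$.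 For $n\ge 2$ let $F_n:\widehat{TL}_n(q)\to\widehat{TL}_{n+1}(q)$ be the homomorphism of $K$-algebras that sends the generator $g_{\sigma_i}$ of $\widehat{TL}_n(q)$ to $g_{\sigma_i}$ for $1\le i\le n-1$ and the generator $g_{a_n}$ to $g_{\sigma_n}g_{a_{n+1}}g_{\sigma_n}^{-1}$. A Markov element of $\widehat{TL}_{n+1}(q)$ is an element of the form $A\,g_{\sigma_n}^{\varepsilon}B$ with $A,B\in F_n(\widehat{TL}_n(q))$ and $\varepsilon\in\{0,1\}$. A trace on $\widehat{TL}_{n+1}(q)$ is a $K$-linear map $\tau:\widehat{TL}_{n+1}(q)\to K$ with $\tau(xy)=\tau(yx)$ for all $x,y$. Theorem. Let $n\ge 2$. Any trace on $\widehat{TL}_{n+1}(q)$ is uniquely determined by its values on the Markov elements: if two traces on $\widehat{TL}_{n+1}(q)$ take the same value at every Markov element, then they are equal. -/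

import Mathlib

/-- The Temperley–Lieb element `V(x, y) = xyx + xy + yx + x + y + 1` of a ring. -/
def tlV {R : Type*} [Ring R] (x y : R) : R :=
  x * y * x + x * y + y * x + x + y + 1

/-- Names of the generators of the affine Temperley–Lieb algebra of rank `n`:
`σ₁, …, σₙ₋₁` and `aₙ`. For `n ≤ 1` there are none. -/
inductive AffGen (n : ℕ) : Type
  | sigma (i : ℕ) (h₁ : 1 ≤ i) (h₂ : i + 1 ≤ n) : AffGen n
  | a (h : 2 ≤ n) : AffGen n

/-- The defining relations of the affine Temperley–Lieb algebra of rank `n`, imposed on the free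
algebra on the generators. For `n = 2` only the two quadratic relations are present. -/
inductive AffRel (K : Type*) [CommRing K] (q : K) (n : ℕ) :
    FreeAlgebra K (AffGen n) → FreeAlgebra K (AffGen n) → Prop
  | comm_sigma (i j : ℕ) (hi₁ : 1 ≤ i) (hi₂ : i + 1 ≤ n) (hj₁ : 1 ≤ j) (hj₂ : j + 1 ≤ n)
      (hij : i + 2 ≤ j ∨ j + 2 ≤ i) :
      AffRel K q n
        (FreeAlgebra.ι K (.sigma i hi₁ hi₂) * FreeAlgebra.ι K (.sigma j hj₁ hj₂))
        (FreeAlgebra.ι K (.sigma j hj₁ hj₂) * FreeAlgebra.ι K (.sigma i hi₁ hi₂))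
  | comm_a (i : ℕ) (hi₁ : 2 ≤ i) (hi₂ : i + 2 ≤ n) :
      AffRel K q n
        (FreeAlgebra.ι K (.sigma i (by omega) (by omega)) * FreeAlgebra.ι K (.a (by omega)))
        (FreeAlgebra.ι K (.a (by omega)) * FreeAlgebra.ι K (.sigma i (by omega) (by omega)))
  | braid_sigma (i : ℕ) (hi₁ : 1 ≤ i) (hi₂ : i + 2 ≤ n) :
      AffRel K q n
        (FreeAlgebra.ι K (.sigma i (by omega) (by omega)) *
          FreeAlgebra.ι K (.sigma (i + 1) (by omega) (by omega)) *
          FreeAlgebra.ι K (.sigma i (by omega) (by omega)))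
        (FreeAlgebra.ι K (.sigma (i + 1) (by omega) (by omega)) *
          FreeAlgebra.ι K (.sigma i (by omega) (by omega)) *
          FreeAlgebra.ι K (.sigma (i + 1) (by omega) (by omega)))
  | braid_a (i : ℕ) (hn : 3 ≤ n) (hi : i = 1 ∨ i + 1 = n) :
      AffRel K q n
        (FreeAlgebra.ι K (.sigma i (by omega) (by omega)) * FreeAlgebra.ι K (.a (by omega)) *
          FreeAlgebra.ι K (.sigma i (by omega) (by omega)))
        (FreeAlgebra.ι K (.a (by omega)) * FreeAlgebra.ι K (.sigma i (by omega) (by omega)) *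
          FreeAlgebra.ι K (.a (by omega)))
  | quadratic (s : AffGen n) :
      AffRel K q n (FreeAlgebra.ι K s * FreeAlgebra.ι K s)
        ((q - 1) • FreeAlgebra.ι K s + algebraMap K _ q)
  | tl_sigma (i : ℕ) (hi₁ : 1 ≤ i) (hi₂ : i + 2 ≤ n) :
      AffRel K q n
        (tlV (FreeAlgebra.ι K (.sigma i (by omega) (by omega)))
          (FreeAlgebra.ι K (.sigma (i + 1) (by omega) (by omega)))) 0
  | tl_a (i : ℕ) (hn : 3 ≤ n) (hi : i = 1 ∨ i + 1 = n) :
      AffRel K q n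
        (tlV (FreeAlgebra.ι K (.sigma i (by omega) (by omega)))
          (FreeAlgebra.ι K (.a (by omega)))) 0

/-- The affine Temperley–Lieb algebra of rank `n` with parameter `q` over `K`: the unital
associative `K`-algebra presented by the generators `AffGen n` and the relations `AffRel K q n`.
It is `K` itself for `n = 1`. -/
abbrev AffineTL (K : Type*) [CommRing K] (q : K) (n : ℕ) : Type _ :=
  RingQuot (AffRel K q n)

namespace AffineTL

section
variable {K : Type*} [CommRing K]

/-- The generator of the affine Temperley–Lieb algebra with a given name. -/
def gen (q : K) {n : ℕ} (s : AffGen n) : AffineTL K q n :=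
  RingQuot.mkAlgHom K (AffRel K q n) (FreeAlgebra.ι K s)

/-- The generator `g_{σᵢ}`, for `1 ≤ i ≤ n - 1`. -/
def gSigma (q : K) {n : ℕ} (i : ℕ) (h₁ : 1 ≤ i) (h₂ : i + 1 ≤ n) : AffineTL K q n :=
  gen q (.sigma i h₁ h₂)

/-- The generator `g_{aₙ}`, for `n ≥ 2`. -/
def gA (q : K) {n : ℕ} (h : 2 ≤ n) : AffineTL K q n :=
  gen q (.a h)

theorem gen_mul_self (q : K) {n : ℕ} (s : AffGen n) :
    gen q s * gen q s = (q - 1) • gen q s + algebraMap K _ q := by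
  have h := RingQuot.mkAlgHom_rel K (AffRel.quadratic (q := q) s)
  simpa [gen] using h

theorem gSigma_comm (q : K) {n : ℕ} (i j : ℕ) (hi₁ : 1 ≤ i) (hi₂ : i + 1 ≤ n) (hj₁ : 1 ≤ j)
    (hj₂ : j + 1 ≤ n) (hij : i + 2 ≤ j ∨ j + 2 ≤ i) :
    gSigma q i hi₁ hi₂ * gSigma q j hj₁ hj₂ = gSigma q j hj₁ hj₂ * gSigma q i hi₁ hi₂ := by
  have h := RingQuot.mkAlgHom_rel K (AffRel.comm_sigma (q := q) i j hi₁ hi₂ hj₁ hj₂ hij)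
  simpa [gSigma, gen] using h

theorem gSigma_gA_comm (q : K) {n : ℕ} (i : ℕ) (hi₁ : 2 ≤ i) (hi₂ : i + 2 ≤ n) :
    gSigma q (n := n) i (by omega) (by omega) * gA q (by omega) =
      gA q (by omega) * gSigma q i (by omega) (by omega) := by
  have h := RingQuot.mkAlgHom_rel K (AffRel.comm_a (q := q) i hi₁ hi₂)
  simpa [gSigma, gA, gen] using h

theorem gSigma_braid (q : K) {n : ℕ} (i : ℕ) (hi₁ : 1 ≤ i) (hi₂ : i + 2 ≤ n) :
    gSigma q (n := n) i (by omega) (by omega) * gSigma q (i + 1) (by omega) (by omega) *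
        gSigma q i (by omega) (by omega) =
      gSigma q (i + 1) (by omega) (by omega) * gSigma q i (by omega) (by omega) *
        gSigma q (i + 1) (by omega) (by omega) := by
  have h := RingQuot.mkAlgHom_rel K (AffRel.braid_sigma (q := q) i hi₁ hi₂)
  simpa [gSigma, gA, gen] using h

theorem gSigma_gA_braid (q : K) {n : ℕ} (i : ℕ) (hn : 3 ≤ n) (hi : i = 1 ∨ i + 1 = n) :
    gSigma q (n := n) i (by omega) (by omega) * gA q (by omega) *
        gSigma q i (by omega) (by omega) =
      gA q (by omega) * gSigma q i (by omega) (by omega) * gA q (by omega) := by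
  have h := RingQuot.mkAlgHom_rel K (AffRel.braid_a (q := q) i hn hi)
  simpa [gSigma, gA, gen] using h

theorem map_tlV {R S : Type*} [Ring R] [Ring S] (f : R →+* S) (x y : R) :
    f (tlV x y) = tlV (f x) (f y) := by
  simp [tlV]

theorem tlV_gSigma (q : K) {n : ℕ} (i : ℕ) (hi₁ : 1 ≤ i) (hi₂ : i + 2 ≤ n) :
    tlV (gSigma q (n := n) i (by omega) (by omega)) (gSigma q (i + 1) (by omega) (by omega)) =
      0 := by
  have h := RingQuot.mkAlgHom_rel K (AffRel.tl_sigma (q := q) i hi₁ hi₂)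
  simpa [gSigma, gA, gen, tlV] using h

theorem tlV_gSigma_gA (q : K) {n : ℕ} (i : ℕ) (hn : 3 ≤ n) (hi : i = 1 ∨ i + 1 = n) :
    tlV (gSigma q (n := n) i (by omega) (by omega)) (gA q (by omega)) = 0 := by
  have h := RingQuot.mkAlgHom_rel K (AffRel.tl_a (q := q) i hn hi)
  simpa [gSigma, gA, gen, tlV] using h

/-- When `q` is invertible each generator `g` is a unit, with inverse `q⁻¹ (g - (q - 1))`. -/
def genUnit (q : Kˣ) {n : ℕ} (s : AffGen n) : (AffineTL K (q : K) n)ˣ where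
  val := gen (q : K) s
  inv := ((q⁻¹ : Kˣ) : K) • (gen (q : K) s - algebraMap K _ ((q : K) - 1))
  val_inv := by
    rw [mul_smul_comm, mul_sub, gen_mul_self, ← Algebra.commutes, ← Algebra.smul_def,
      add_sub_cancel_left, Algebra.algebraMap_eq_smul_one, smul_smul, Units.inv_mul, one_smul]
  inv_val := by
    rw [smul_mul_assoc, sub_mul, gen_mul_self, ← Algebra.smul_def,
      add_sub_cancel_left, Algebra.algebraMap_eq_smul_one, smul_smul, Units.inv_mul, one_smul]

/-- The generator `g_{σᵢ}` as a unit. -/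
def uSigma (q : Kˣ) {n : ℕ} (i : ℕ) (h₁ : 1 ≤ i) (h₂ : i + 1 ≤ n) : (AffineTL K (q : K) n)ˣ :=
  genUnit q (.sigma i h₁ h₂)

/-- The images of the generators under the tower morphism from rank `n` to rank `n + 1`:
`σᵢ ↦ g_{σᵢ}` for `1 ≤ i ≤ n - 1`, and `aₙ ↦ g_{σₙ} g_{aₙ₊₁} g_{σₙ}⁻¹`. -/
def towerGen (q : Kˣ) {n : ℕ} : AffGen n → AffineTL K (q : K) (n + 1)
  | .sigma i h₁ h₂ => gSigma (q : K) i h₁ (by omega)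
  | .a h => gSigma (q : K) n (by omega) le_rfl * gA (q : K) (n := n + 1) (by omega) *
      (((uSigma q n (by omega) le_rfl)⁻¹ : (AffineTL K (q : K) (n + 1))ˣ) :
        AffineTL K (q : K) (n + 1))

theorem val_uSigma (q : Kˣ) {n : ℕ} (i : ℕ) (h₁ : 1 ≤ i) (h₂ : i + 1 ≤ n) :
    ((uSigma q i h₁ h₂ : (AffineTL K (q : K) n)ˣ) : AffineTL K (q : K) n) =
      gSigma (q : K) i h₁ h₂ := rfl

theorem tlV_conj {R : Type*} [Ring R] (u : Rˣ) (x y : R) :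
    tlV ((u : R) * x * (u⁻¹ : Rˣ)) ((u : R) * y * (u⁻¹ : Rˣ)) = u * tlV x y * (u⁻¹ : Rˣ) := by
  simp [tlV, mul_add, add_mul, mul_assoc]

theorem conj_of_commute {R : Type*} [Ring R] (u : Rˣ) {x : R} (h : x * (u : R) = u * x) :
    (u : R) * x * (u⁻¹ : Rˣ) = x := by
  rw [← h, mul_assoc, Units.mul_inv, mul_one]

theorem conj_mul_conj {R : Type*} [Ring R] (u : Rˣ) (x y : R) :
    ((u : R) * x * (u⁻¹ : Rˣ)) * ((u : R) * y * (u⁻¹ : Rˣ)) = u * (x * y) * (u⁻¹ : Rˣ) := by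
  simp [mul_assoc]

theorem conj_braid {R : Type*} [Ring R] (u x : Rˣ) (h : (x : R) * u * x = u * x * u) :
    (x : R) = ((u * x : Rˣ) : R) * u * ((u * x)⁻¹ : Rˣ) := by
  rw [Units.eq_mul_inv_iff_mul_eq, Units.val_mul, ← mul_assoc, h]

theorem towerGen_a (q : Kˣ) {n : ℕ} (h : 2 ≤ n) :
    towerGen q (.a h) =
      ((uSigma q n (by omega) le_rfl : (AffineTL K (q : K) (n + 1))ˣ) :
          AffineTL K (q : K) (n + 1)) * gA (q : K) (by omega) *
        (((uSigma q n (by omega) le_rfl)⁻¹ : (AffineTL K (q : K) (n + 1))ˣ) :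
          AffineTL K (q : K) (n + 1)) := rfl

/-- For `i = 1` or `i = n - 1` the images of `σᵢ` and `aₙ` are simultaneously conjugate to
neighbouring generators of the algebra of rank `n + 1`. -/
theorem towerGen_conj (q : Kˣ) {n : ℕ} (i : ℕ) (hn : 3 ≤ n) (hi : i = 1 ∨ i + 1 = n) :
    ∃ (w : (AffineTL K (q : K) (n + 1))ˣ) (j : ℕ) (hj : j = 1 ∨ j + 1 = n + 1),
      towerGen q (n := n) (.sigma i (by omega) (by omega)) =
        w * gSigma (q : K) (n := n + 1) j (by omega) (by omega) * (w⁻¹ : (AffineTL K (q : K) (n + 1))ˣ) ∧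
      towerGen q (n := n) (.a (by omega)) =
        w * gA (q : K) (n := n + 1) (by omega) * (w⁻¹ : (AffineTL K (q : K) (n + 1))ˣ) := by
  rcases hi with rfl | hi
  · refine ⟨uSigma q n (by omega) le_rfl, 1, Or.inl rfl, ?_, rfl⟩
    refine (conj_of_commute _ ?_).symm
    exact gSigma_comm (q : K) 1 n _ _ _ _ (by omega)
  · refine ⟨uSigma q n (by omega) le_rfl * uSigma q i (by omega) (by omega), n, Or.inr rfl,
      ?_, ?_⟩
    · refine conj_braid (uSigma q n (by omega) le_rfl) (uSigma q i (by omega) (by omega)) ?_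
      subst hi
      exact gSigma_braid (q : K) i _ _
    · have h := conj_of_commute (uSigma q (n := n + 1) i (by omega) (by omega))
        (gSigma_gA_comm (q : K) (n := n + 1) i (by omega) (by omega)).symm
      rw [towerGen_a]
      conv_lhs => rw [← h]
      simp [mul_assoc]

/-- The images of the generators of rank `n` satisfy the defining relations of rank `n`. -/
theorem towerGen_rel (q : Kˣ) {n : ℕ} ⦃x y : FreeAlgebra K (AffGen n)⦄
    (h : AffRel K (q : K) n x y) :
    FreeAlgebra.lift K (towerGen q) x = FreeAlgebra.lift K (towerGen q) y := by
  cases h with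
  | comm_sigma i j hi₁ hi₂ hj₁ hj₂ hij =>
    simpa [towerGen] using gSigma_comm (q : K) i j _ _ _ _ hij
  | comm_a i hi₁ hi₂ =>
    simp only [map_mul, FreeAlgebra.lift_ι_apply]
    have hc := conj_of_commute (uSigma q (n := n + 1) n (by omega) le_rfl)
      (gSigma_comm (q : K) i n (by omega) (by omega) (by omega) le_rfl (by omega))
    have h₁ : towerGen q (n := n) (.sigma i (by omega) (by omega)) = _ := hc.symm
    rw [h₁, towerGen_a, conj_mul_conj, conj_mul_conj, gSigma_gA_comm (q : K) i hi₁ (by omega)]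
  | braid_sigma i hi₁ hi₂ =>
    simpa [towerGen] using gSigma_braid (q : K) (n := n + 1) i hi₁ (by omega)
  | braid_a i hn hi =>
    obtain ⟨w, j, hj, h₁, h₂⟩ := towerGen_conj q i hn hi
    simp only [map_mul, FreeAlgebra.lift_ι_apply]
    rw [h₁, h₂]
    simp only [conj_mul_conj]
    rw [gSigma_gA_braid (q : K) j (by omega) hj]
  | quadratic s =>
    simp only [map_mul, map_add, map_smul, FreeAlgebra.lift_ι_apply, AlgHom.commutes]
    cases s with
    | sigma i h₁ h₂ => exact gen_mul_self (q : K) _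
    | a h =>
      rw [towerGen_a, conj_mul_conj, gA, gen_mul_self, mul_add, add_mul, mul_smul_comm, smul_mul_assoc,
        ← Algebra.commutes (q : K) ((uSigma q n _ _ : (AffineTL K (q : K) (n + 1))ˣ) :
          AffineTL K (q : K) (n + 1)), mul_assoc (algebraMap K _ (q : K)), Units.mul_inv, mul_one]
  | tl_sigma i hi₁ hi₂ =>
    simpa [towerGen, tlV] using tlV_gSigma (q : K) (n := n + 1) i hi₁ (by omega)
  | tl_a i hn hi =>
    obtain ⟨w, j, hj, h₁, h₂⟩ := towerGen_conj q i hn hi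
    have := map_tlV (FreeAlgebra.lift K (towerGen q (n := n))).toRingHom
      (FreeAlgebra.ι K (.sigma i (by omega) (by omega))) (FreeAlgebra.ι K (.a (by omega)))
    simp only [AlgHom.toRingHom_eq_coe, RingHom.coe_coe, FreeAlgebra.lift_ι_apply] at this
    rw [this, h₁, h₂, tlV_conj, tlV_gSigma_gA (q : K) j (by omega) hj]
    simp

/-- The tower morphism `Fₙ` from the affine Temperley–Lieb algebra of rank `n` to that of rank
`n + 1`: `t_{σᵢ} ↦ g_{σᵢ}` for `1 ≤ i ≤ n - 1` and `t_{aₙ} ↦ g_{σₙ} g_{aₙ₊₁} g_{σₙ}⁻¹`. -/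
def F (q : Kˣ) (n : ℕ) : AffineTL K (q : K) n →ₐ[K] AffineTL K (q : K) (n + 1) :=
  RingQuot.liftAlgHom K ⟨FreeAlgebra.lift K (towerGen q), towerGen_rel q⟩

theorem F_gen (q : Kˣ) (n : ℕ) (s : AffGen n) : F q n (gen (q : K) s) = towerGen q s := by
  simp [F, gen]

/-- Markov elements of the affine Temperley–Lieb algebra of rank `n + 1`: the elements
`A g_{σₙ}^ε B` with `A`, `B` in the image of `Fₙ` and `ε ∈ {0, 1}`. -/
def IsMarkov (q : Kˣ) {n : ℕ} (hn : 2 ≤ n) (x : AffineTL K (q : K) (n + 1)) : Prop :=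
  ∃ A ∈ (F q n).range, ∃ B ∈ (F q n).range, ∃ ε : ℕ, (ε = 0 ∨ ε = 1) ∧
    x = A * gSigma (q : K) n (by omega) le_rfl ^ ε * B

end

end AffineTL

/-- A trace on a `K`-algebra: a `K`-linear form `τ` with `τ (x y) = τ (y x)`. -/
def IsTraceForm {K R : Type*} [CommRing K] [Ring R] [Algebra K R] (τ : R →ₗ[K] K) : Prop :=
  ∀ x y : R, τ (x * y) = τ (y * x)

/-!
The shifted generators `xᵢ = g + 1` satisfy the homogeneous relations `xᵢ ^ 2 = (q + 1) xᵢ`,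
`xᵢ xⱼ xᵢ = q xᵢ` for neighbours on the cycle `0, …, n`, and commute otherwise. Let `U` be the
algebra generated by `x₁, …, xₙ₋₁`, put `P = U x₀ U` and `Q = U xₙ U`, and let `E = U + P + Q` be
the span of the words with at most one end letter `x₀`, `xₙ`.

The normal form of Temperley–Lieb words of type `A` gives `P ^ 2 ≤ P` and `Q ^ 2 ≤ Q`, so
`E ^ (2k + 2) ≤ (P Q) ^ (k + 1) + (Q P) ^ (k + 1) + E ^ (2k + 1)`. It also gives
`Q P ≤ G + K t + E` with `G = U xₙ x₀ U` and the tour `t = xₙ ⋯ x₁ x₀`. Multiplying `t` by a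
generator of `U` leads into `G + E`, and multiplying it by `xₙ x₀` only rescales it, whence
`(Q P) ^ (k + 1) ≤ G ^ (k + 1) + K t ^ (k + 1) + E ^ (2k + 1)`.

Let `S` be the image of `F`. It contains `U` and `c = gₙ g gₙ⁻¹ + 1`, where `x₀ = g + 1` and
`xₙ = gₙ + 1`. Since `c = xₙ + x₀ - xₙ x₀ - q⁻¹ x₀ xₙ`, a product of `k + 1` factors from `G`, or
from `G' = U x₀ xₙ U`, is modulo `E ^ (2k + 1)` one such factor times a power of `U c U ≤ S`. It
lies in `S xₙ S`, because `xₙ c = q (xₙ - xₙ x₀)` and `c xₙ = xₙ - q⁻¹ x₀ xₙ`.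

The difference `τ` of two traces that agree on Markov elements vanishes on `S` and `S xₙ S`. Being
cyclic, it vanishes on `t ^ (k + 1)`, which rotates into `G' ^ (k + 1)`, and it vanishes on
`(P Q) ^ (k + 1)` as soon as it does on `(Q P) ^ (k + 1)`. By induction on `k`, `τ` is zero on every
power of `E`.
-/

section Growth

variable {A : Type*} [IdemSemiring A] {B C E L U X Y Z : A}

theorem mul_pow_le_pow_succ_add (hX : X ≤ E ^ 2) (hY : Y ≤ E ^ 2)
    (hXY : X * Y ≤ X ^ 2 + E ^ 3) (k : ℕ) : X * Y ^ k ≤ X ^ (k + 1) + E ^ (2 * k + 1) := by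
  induction k with
  | zero => simp
  | succ k ih =>
    calc X * Y ^ (k + 1) = X * Y ^ k * Y := by rw [pow_succ, mul_assoc]
      _ ≤ (X ^ (k + 1) + E ^ (2 * k + 1)) * Y := by gcongr
      _ = X ^ k * (X * Y) + E ^ (2 * k + 1) * Y := by rw [add_mul, pow_succ, mul_assoc]
      _ ≤ X ^ k * (X ^ 2 + E ^ 3) + E ^ (2 * k + 1) * E ^ 2 := by gcongr
      _ = X ^ (k + 2) + X ^ k * E ^ 3 + E ^ (2 * k + 3) := by
        rw [mul_add, ← pow_add, ← pow_add]
      _ ≤ X ^ (k + 2) + (E ^ 2) ^ k * E ^ 3 + E ^ (2 * k + 3) := by gcongr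
      _ = X ^ (k + 2) + E ^ (2 * k + 3) := by
        rw [← pow_mul, ← pow_add, add_assoc, add_idem]

theorem mul_pow_succ_le_pow_add (hX : X ≤ E ^ 2) (hYX : Y * X ≤ X ^ 2 + E ^ 3) (k : ℕ) :
    Y * X ^ (k + 1) ≤ X ^ (k + 2) + E ^ (2 * k + 3) := by
  calc Y * X ^ (k + 1) = Y * X * X ^ k := by rw [pow_succ', mul_assoc]
    _ ≤ (X ^ 2 + E ^ 3) * X ^ k := by gcongr
    _ = X ^ (k + 2) + E ^ 3 * X ^ k := by rw [add_mul, ← pow_add, add_comm 2]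
    _ ≤ X ^ (k + 2) + E ^ 3 * (E ^ 2) ^ k := by gcongr
    _ = X ^ (k + 2) + E ^ (2 * k + 3) := by rw [← pow_mul, ← pow_add, add_comm 3]

theorem pow_succ_le_pow_add_pow_add (hE : 1 ≤ E) (hX : X ≤ E ^ 2) (hY : Y ≤ E ^ 2)
    (hXY : X * Y ≤ X ^ 2 + E ^ 3) (hYX : Y * X ≤ X ^ 2 + E ^ 3) (hZ : Z ≤ X + Y + E) (k : ℕ) :
    Z ^ (k + 1) ≤ X ^ (k + 1) + Y ^ (k + 1) + E ^ (2 * k + 1) := by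
  induction k with
  | zero => simpa using hZ
  | succ k ih =>
    have hEV {V : A} (hV : V ≤ E ^ 2) : E * V ^ (k + 1) ≤ E ^ (2 * k + 3) := by
      calc E * V ^ (k + 1) ≤ E * (E ^ 2) ^ (k + 1) := by gcongr
        _ = E ^ (2 * k + 3) := by rw [← pow_mul, ← pow_succ', mul_add_one]
    have hZE : Z * E ^ (2 * k + 1) ≤ E ^ (2 * k + 3) := by
      calc Z * E ^ (2 * k + 1) ≤ (E ^ 2 + E ^ 2 + E ^ 2) * E ^ (2 * k + 1) := by
            gcongr
            exact hZ.trans (by gcongr; exact le_self_pow₀ hE two_ne_zero)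
        _ = E ^ (2 * k + 3) := by rw [add_idem, add_idem, ← pow_add, add_comm 2]
    have hXY' := mul_pow_le_pow_succ_add hX hY hXY (k + 1)
    have hYX' := mul_pow_succ_le_pow_add hX hYX k
    calc Z ^ (k + 2) = Z * Z ^ (k + 1) := pow_succ' ..
      _ ≤ Z * (X ^ (k + 1) + Y ^ (k + 1) + E ^ (2 * k + 1)) := by gcongr
      _ = Z * (X ^ (k + 1) + Y ^ (k + 1)) + Z * E ^ (2 * k + 1) := mul_add ..
      _ ≤ (X + Y + E) * (X ^ (k + 1) + Y ^ (k + 1)) + E ^ (2 * k + 3) := by gcongr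
      _ = X ^ (k + 2) + Y * X ^ (k + 1) + E * X ^ (k + 1) +
          (X * Y ^ (k + 1) + Y ^ (k + 2) + E * Y ^ (k + 1)) + E ^ (2 * k + 3) := by
        simp only [add_mul, mul_add, ← pow_succ', add_assoc]
      _ ≤ X ^ (k + 2) + (X ^ (k + 2) + E ^ (2 * k + 3)) + E ^ (2 * k + 3) +
          ((X ^ (k + 2) + E ^ (2 * k + 3)) + Y ^ (k + 2) + E ^ (2 * k + 3)) +
          E ^ (2 * k + 3) := by
        gcongr
        exacts [hEV hX, hXY', hEV hY]
      _ = X ^ (k + 2) + Y ^ (k + 2) + E ^ (2 * k + 3) := by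
        simp only [add_eq_sup]; ac_nf

theorem pow_succ_le_mul_pow_add (hX : X ≤ E ^ 2) (hC : C ≤ E ^ 2)
    (hXC : X ≤ C + Y + E) (hXY : X * Y ≤ E ^ 3) (k : ℕ) :
    X ^ (k + 1) ≤ X * C ^ k + E ^ (2 * k + 1) := by
  have hXX : X * X ≤ X * C + E ^ 3 := by
    calc X * X ≤ X * (C + Y + E) := by gcongr
      _ = X * C + (X * Y + X * E) := by rw [mul_add, mul_add, add_assoc]
      _ ≤ X * C + (E ^ 3 + E ^ 2 * E) := by gcongr
      _ = X * C + E ^ 3 := by rw [← pow_succ, add_idem]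
  induction k with
  | zero => simp
  | succ k ih =>
    calc X ^ (k + 1 + 1) = X * X ^ (k + 1) := pow_succ' ..
      _ ≤ X * (X * C ^ k + E ^ (2 * k + 1)) := by gcongr
      _ = X * X * C ^ k + X * E ^ (2 * k + 1) := by rw [mul_add, mul_assoc]
      _ ≤ (X * C + E ^ 3) * (C ^ k) + E ^ 2 * E ^ (2 * k + 1) := by gcongr
      _ = X * C ^ (k + 1) + (E ^ 3 * C ^ k + E ^ (2 * k + 3)) := by
        rw [add_mul, mul_assoc, ← pow_succ', ← pow_add, add_assoc, add_comm 2]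
      _ ≤ X * C ^ (k + 1) + (E ^ 3 * (E ^ 2) ^ k + E ^ (2 * k + 3)) := by gcongr
      _ = X * C ^ (k + 1) + E ^ (2 * k + 3) := by
        rw [← pow_mul, ← pow_add, add_comm 3, add_idem]

theorem mul_mul_mul_le_pow_three (hX : X ≤ E) (hY : Y ≤ E) (hYY : Y * Y ≤ Y) :
    X * Y * (Y * X) ≤ E ^ 3 := by
  calc X * Y * (Y * X) = X * (Y * Y) * X := by simp only [mul_assoc]
    _ ≤ E * E * E := by gcongr; exact hYY.trans hY
    _ = E ^ 3 := (pow_three' E).symm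

theorem mul_le_sq_add_pow_three (hU : 1 ≤ U) (hE : 1 ≤ E) (hBL : B * L ≤ L)
    (hUL : U * L ≤ U * B * U + L + E) (hB : U * B * U ≤ E ^ 2) (hL : L ≤ E ^ 2) :
    U * B * U * L ≤ (U * B * U) ^ 2 + E ^ 3 := by
  have hUB : U * B ≤ U * B * U := le_mul_of_one_le_right' hU
  have hUL' : U * L ≤ E ^ 3 := by
    calc U * L ≤ E ^ 2 + E ^ 2 + E ^ 2 :=
        hUL.trans (by gcongr; exact le_self_pow₀ hE two_ne_zero)
      _ ≤ E ^ 3 := by rw [add_idem, add_idem]; exact pow_le_pow_right' hE (by omega)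
  calc U * B * U * L = U * B * (U * L) := mul_assoc ..
    _ ≤ U * B * (U * B * U + L + E) := by gcongr
    _ = U * B * (U * B * U) + U * (B * L) + U * B * E := by simp only [mul_add, mul_assoc]
    _ ≤ U * B * U * (U * B * U) + U * L + U * B * U * E := by
      gcongr
    _ ≤ (U * B * U) ^ 2 + E ^ 3 + E ^ 2 * E := by gcongr; exact (sq _).ge
    _ = (U * B * U) ^ 2 + E ^ 3 := by rw [← pow_succ, add_assoc, add_idem]

theorem mul_le_sq_add_pow_three' (hU : 1 ≤ U) (hE : 1 ≤ E) (hLB : L * B ≤ L)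
    (hLU : L * U ≤ U * B * U + L + E) (hB : U * B * U ≤ E ^ 2) (hL : L ≤ E ^ 2) :
    L * (U * B * U) ≤ (U * B * U) ^ 2 + E ^ 3 := by
  have hLU' : L * U ≤ E ^ 3 := by
    calc L * U ≤ E ^ 2 + E ^ 2 + E ^ 2 :=
        hLU.trans (by gcongr; exact le_self_pow₀ hE two_ne_zero)
      _ ≤ E ^ 3 := by rw [add_idem, add_idem]; exact pow_le_pow_right' hE (by omega)
  have hBU : B * U ≤ U * B * U := by rw [mul_assoc]; exact le_mul_of_one_le_left' hU
  calc L * (U * B * U) = L * U * (B * U) := by simp only [mul_assoc]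
    _ ≤ (U * B * U + L + E) * (B * U) := by gcongr
    _ = U * B * U * (B * U) + L * B * U + E * (B * U) := by simp only [add_mul, mul_assoc]
    _ ≤ U * B * U * (U * B * U) + L * U + E * (U * B * U) := by gcongr
    _ ≤ (U * B * U) ^ 2 + E ^ 3 + E * E ^ 2 := by gcongr; exact (sq _).ge
    _ = (U * B * U) ^ 2 + E ^ 3 := by rw [← pow_succ', add_assoc, add_idem]

theorem mul_pow_le_of_mul_le (h : X * Y ≤ X) (k : ℕ) : X * Y ^ k ≤ X := by
  induction k with
  | zero => simp
  | succ k ih => rw [pow_succ', ← mul_assoc]; grw [h, ih]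

end Growth

section Bispan

variable {K R : Type*} [CommSemiring K] [Semiring R] [Algebra K R]

open Submodule Algebra

variable {x y : R} {s : Set R} {N N' : Submodule K R} {U U' : Subalgebra K R}

theorem span_singleton_mul_span_singleton (x y : R) : (K ∙ x) * (K ∙ y) = K ∙ (x * y) := by
  rw [span_mul_span, Set.singleton_mul_singleton]

theorem span_singleton_mul_adjoin_comm (h : ∀ y ∈ s, Commute x y) :
    (K ∙ x) * (adjoin K s).toSubmodule = (adjoin K s).toSubmodule * (K ∙ x) := by
  refine mul_comm_of_commute fun z hz w hw ↦ ?_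
  obtain ⟨c, rfl⟩ := mem_span_singleton.1 hz
  have : adjoin K s ≤ Subalgebra.centralizer K {x} :=
    adjoin_le fun y hy ↦ by simpa [Set.mem_centralizer_iff] using (h y hy).eq
  exact Commute.smul_left (Subalgebra.mem_centralizer_iff K |>.1 (this hw) x rfl) c

theorem mul_adjoin_le (hN : N ≤ N') (hs : ∀ y ∈ s, N' * (K ∙ y) ≤ N') :
    N * (adjoin K s).toSubmodule ≤ N' := by
  refine mul_le.2 fun z hz w hw ↦ ?_
  suffices (adjoin K s).toSubmodule ≤ N'.comap (LinearMap.mulLeft K z) from this hw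
  rw [adjoin_eq_span, span_le]
  intro w hw
  induction hw using Submonoid.closure_induction_right with
  | one => simpa using hN hz
  | mul_right w _ y hy ih =>
    simpa [mul_assoc] using hs y hy (mul_mem_mul ih (mem_span_singleton_self y))

theorem adjoin_mul_le (hN : N ≤ N') (hs : ∀ y ∈ s, (K ∙ y) * N' ≤ N') :
    (adjoin K s).toSubmodule * N ≤ N' := by
  refine mul_le.2 fun w hw z hz ↦ ?_
  suffices (adjoin K s).toSubmodule ≤ N'.comap (LinearMap.mulRight K z) from this hw
  rw [adjoin_eq_span, span_le]
  intro w hw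
  induction hw using Submonoid.closure_induction_left with
  | one => simpa using hN hz
  | mul_left y hy w _ ih =>
    simpa [mul_assoc] using hs y hy (mul_mem_mul (mem_span_singleton_self y) ih)

/-- The `U`-bimodule `U x U` generated by `x`, for a subalgebra `U`. -/
def bispan (U : Subalgebra K R) (x : R) : Submodule K R :=
  U.toSubmodule * (K ∙ x) * U.toSubmodule

theorem one_le_toSubmodule (U : Subalgebra K R) : 1 ≤ U.toSubmodule :=
  one_le.2 (one_mem U)

theorem span_singleton_le_toSubmodule (hx : x ∈ U) : (K ∙ x) ≤ U.toSubmodule :=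
  (span_singleton_le_iff_mem _ _).2 hx

theorem span_singleton_mul_toSubmodule_le (hx : x ∈ U) :
    (K ∙ x) * U.toSubmodule ≤ U.toSubmodule := by
  grw [span_singleton_le_toSubmodule hx, U.isIdempotentElem_toSubmodule.eq]

@[simp]
theorem toSubmodule_mul_bispan : U.toSubmodule * bispan U x = bispan U x := by
  rw [bispan, mul_assoc, ← mul_assoc, U.isIdempotentElem_toSubmodule.eq]

@[simp]
theorem bispan_mul_toSubmodule : bispan U x * U.toSubmodule = bispan U x := by
  rw [bispan, mul_assoc, U.isIdempotentElem_toSubmodule.eq]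

theorem span_singleton_le_bispan : (K ∙ x) ≤ bispan U x := by
  calc (K ∙ x) = 1 * (K ∙ x) * 1 := by rw [one_mul, mul_one]
    _ ≤ bispan U x := by rw [bispan]; gcongr <;> exact one_le_toSubmodule U

theorem bispan_le (hx : (K ∙ x) ≤ N) (hl : U.toSubmodule * N ≤ N) (hr : N * U.toSubmodule ≤ N) :
    bispan U x ≤ N := by
  grw [bispan, hx, hl, hr]

theorem mem_bispan_self : x ∈ bispan U x :=
  span_singleton_le_bispan (mem_span_singleton_self x)

theorem bispan_le_toSubmodule (hx : x ∈ U) : bispan U x ≤ U.toSubmodule :=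
  bispan_le (span_singleton_le_toSubmodule hx) U.isIdempotentElem_toSubmodule.eq.le
    U.isIdempotentElem_toSubmodule.eq.le

theorem bispan_mono (h : U ≤ U') : bispan U x ≤ bispan U' x := by
  have h' : U.toSubmodule ≤ U'.toSubmodule := h
  unfold bispan
  gcongr

theorem bispan_le_of_forall_mul_mem (h : ∀ a ∈ U, ∀ b ∈ U, a * x * b ∈ N) : bispan U x ≤ N := by
  refine mul_le.2 fun z hz b hb ↦ ?_
  induction hz using Submodule.mul_induction_on' with
  | mem_mul_mem a ha y hy =>
    obtain ⟨c, rfl⟩ := mem_span_singleton.1 hy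
    simpa using smul_mem _ c (h a ha b hb)
  | add y _ z _ hy hz => rw [add_mul]; exact add_mem hy hz

theorem bispan_mul_bispan_le (h : (K ∙ x) * U.toSubmodule * (K ∙ y) ≤ N)
    (hl : U.toSubmodule * N ≤ N) (hr : N * U.toSubmodule ≤ N) :
    bispan U x * bispan U y ≤ N := by
  calc bispan U x * bispan U y
      = U.toSubmodule * ((K ∙ x) * (U.toSubmodule * U.toSubmodule) * (K ∙ y)) *
          U.toSubmodule := by simp only [bispan, mul_assoc]
    _ ≤ N := by rw [U.isIdempotentElem_toSubmodule.eq]; grw [h, hl, hr]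

theorem bispan_mul_le : bispan U (x * y) ≤ bispan U x * bispan U y := by
  refine bispan_le ?_ ?_ ?_
  · rw [← span_singleton_mul_span_singleton]
    exact mul_le_mul' span_singleton_le_bispan span_singleton_le_bispan
  · rw [← mul_assoc, toSubmodule_mul_bispan]
  · rw [mul_assoc, bispan_mul_toSubmodule]

theorem toSubmodule_adjoin_insert_le
    (h : (K ∙ x) * (adjoin K s).toSubmodule * (K ∙ x) ≤ bispan (adjoin K s) x) :
    (adjoin K (insert x s)).toSubmodule ≤
      (adjoin K s).toSubmodule + bispan (adjoin K s) x := by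
  set U := adjoin K s
  rw [← one_mul (adjoin K (insert x s)).toSubmodule]
  refine mul_adjoin_le ((one_le_toSubmodule U).trans le_self_add) ?_
  rintro y (rfl | hy)
  · rw [add_mul]
    refine add_le ?_ ?_
    · exact (le_mul_of_one_le_right' (one_le_toSubmodule U)).trans le_add_self
    · calc bispan U y * (K ∙ y)
          = U.toSubmodule * ((K ∙ y) * U.toSubmodule * (K ∙ y)) := by
            simp only [bispan, mul_assoc]
        _ ≤ U.toSubmodule * bispan U y := by gcongr
        _ ≤ U.toSubmodule + bispan U y := by rw [toSubmodule_mul_bispan]; exact le_add_self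
  · grw [span_singleton_le_toSubmodule (subset_adjoin hy : y ∈ U), add_mul,
      U.isIdempotentElem_toSubmodule.eq, bispan_mul_toSubmodule]

end Bispan

section Chain

variable {K R : Type*} [CommSemiring K] [Semiring R] [Algebra K R]

open Submodule Algebra

variable {x : ℕ → R} {lo hi lo' hi' i j k n : ℕ} {y : R}

variable (K) in
/-- The subalgebra generated by the members `x i`, `lo ≤ i < hi`, of a sequence. -/
def wordAlg (x : ℕ → R) (lo hi : ℕ) : Subalgebra K R :=
  adjoin K (x '' Set.Ico lo hi)

theorem wordAlg_mono (h : lo' ≤ lo) (h' : hi ≤ hi') : wordAlg K x lo hi ≤ wordAlg K x lo' hi' :=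
  adjoin_mono (Set.image_mono (Set.Ico_subset_Ico h h'))

theorem mem_wordAlg (hi₁ : lo ≤ i) (hi₂ : i < hi) : x i ∈ wordAlg K x lo hi :=
  subset_adjoin ⟨i, ⟨hi₁, hi₂⟩, rfl⟩

theorem wordAlg_of_le (h : hi ≤ lo) : wordAlg K x lo hi = ⊥ := by
  rw [wordAlg, Set.Ico_eq_empty (by omega), Set.image_empty, adjoin_empty]

theorem wordAlg_succ (h : lo ≤ hi) :
    wordAlg K x lo (hi + 1) = adjoin K (insert (x hi) (x '' Set.Ico lo hi)) := by
  rw [wordAlg, ← Set.image_insert_eq, Set.insert_Ico_right_eq_Ico_add_one h]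

theorem span_mul_wordAlg_le (h : lo ≤ hi) :
    (K ∙ x hi) * (wordAlg K x lo hi).toSubmodule ≤ (wordAlg K x lo (hi + 1)).toSubmodule := by
  have hmono : (wordAlg K x lo hi).toSubmodule ≤ (wordAlg K x lo (hi + 1)).toSubmodule :=
    wordAlg_mono le_rfl hi.le_succ
  grw [hmono, span_singleton_mul_toSubmodule_le (mem_wordAlg h hi.lt_add_one)]

/-- The descending product `x (j - 1) ⋯ x (i + 1) x i`. -/
def descProd (x : ℕ → R) (i j : ℕ) : R :=
  ((List.Ico i j).reverse.map x).prod

theorem descProd_mul_descProd (hij : i ≤ j) (hjk : j ≤ k) :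
    descProd x j k * descProd x i j = descProd x i k := by
  simp only [descProd, ← List.Ico.append_consecutive hij hjk, List.reverse_append, List.map_append,
    List.prod_append]

theorem descProd_self : descProd x i i = 1 := by
  simp [descProd]

theorem descProd_self_succ : descProd x i (i + 1) = x i := by
  simp [descProd]

theorem descProd_succ (h : i ≤ j) : descProd x i (j + 1) = x j * descProd x i j := by
  rw [← descProd_mul_descProd h j.le_succ, descProd_self_succ]

theorem descProd_zero (hi : 1 ≤ i) : descProd x 0 i = descProd x 1 i * x 0 := by
  rw [← descProd_mul_descProd zero_le_one hi, ← zero_add 1, descProd_self_succ]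

theorem descProd_mem {U : Subalgebra K R} (h : ∀ l, i ≤ l → l < j → x l ∈ U) :
    descProd x i j ∈ U :=
  list_prod_mem (by grind [List.Ico.mem])

theorem commute_descProd (h : ∀ l, i ≤ l → l < j → Commute y (x l)) :
    Commute y (descProd x i j) :=
  Commute.list_prod_right _ _ (by grind [List.Ico.mem])

/-- The relations of the Temperley–Lieb algebra of type `A`, for `x 1, …, x n`, in the
normalisation `x i ^ 2 = δ x i` and `x i x j x i = q x i` for adjacent indices. -/
structure IsTLChain (δ q : K) (x : ℕ → R) (n : ℕ) : Prop where
  mul_self : ∀ i, 1 ≤ i → i ≤ n → x i * x i = δ • x i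
  mul_mul : ∀ i j, 1 ≤ i → i ≤ n → 1 ≤ j → j ≤ n → (j = i + 1 ∨ i = j + 1) →
    x i * x j * x i = q • x i
  commute : ∀ i j, 1 ≤ i → i + 2 ≤ j → j ≤ n → Commute (x i) (x j)

namespace IsTLChain

variable {δ q : K}

theorem span_mul_wordAlg_comm (h : IsTLChain δ q x n) (hij : hi < j) (hjn : j ≤ n) :
    (K ∙ x j) * (wordAlg K x 1 hi).toSubmodule = (wordAlg K x 1 hi).toSubmodule * (K ∙ x j) := by
  refine span_singleton_mul_adjoin_comm ?_
  rintro _ ⟨i, hi, rfl⟩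
  exact (h.commute i j hi.1 (by have := hi.2; omega) hjn).symm

theorem span_mul_span_le (h : IsTLChain δ q x n) (hi₁ : 1 ≤ i) (hin : i ≤ n) :
    (K ∙ x i) * (K ∙ x i) ≤ K ∙ x i := by
  rw [span_singleton_mul_span_singleton, h.mul_self i hi₁ hin]
  exact span_singleton_smul_le K δ _

theorem span_mul_span_mul_span_le (h : IsTLChain δ q x n) (hi₁ : 1 ≤ i) (hin : i + 1 ≤ n) :
    (K ∙ x (i + 1)) * (K ∙ x i) * (K ∙ x (i + 1)) ≤ K ∙ x (i + 1) := by
  rw [span_singleton_mul_span_singleton, span_singleton_mul_span_singleton,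
    h.mul_mul _ i (by omega) hin hi₁ (by omega) (Or.inr rfl)]
  exact span_singleton_smul_le K q _

theorem span_mul_wordAlg_mul_span_le (h : IsTLChain δ q x n) (hi₁ : 1 ≤ hi) (hin : hi ≤ n) :
    (K ∙ x hi) * (wordAlg K x 1 hi).toSubmodule * (K ∙ x hi) ≤
      bispan (wordAlg K x 1 hi) (x hi) := by
  induction hi, hi₁ using Nat.le_induction with
  | base =>
    rw [wordAlg_of_le le_rfl, bispan, toSubmodule_bot, one_mul, mul_one]
    exact h.span_mul_span_le le_rfl hin
  | succ k hk ih =>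
    have hcomm := h.span_mul_wordAlg_comm k.lt_add_one hin
    have hmono : (wordAlg K x 1 k).toSubmodule ≤ (wordAlg K x 1 (k + 1)).toSubmodule :=
      wordAlg_mono le_rfl k.le_succ
    have hadjoin : (wordAlg K x 1 (k + 1)).toSubmodule ≤
        (wordAlg K x 1 k).toSubmodule + bispan (wordAlg K x 1 k) (x k) := by
      rw [wordAlg_succ hk]
      exact toSubmodule_adjoin_insert_le (ih (by omega))
    rw [bispan]
    set W' := (wordAlg K x 1 (k + 1)).toSubmodule
    have hW' : 1 ≤ W' := one_le_toSubmodule _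
    grw [hadjoin]
    rw [bispan]
    set W := (wordAlg K x 1 k).toSubmodule
    set X := K ∙ x (k + 1)
    set Y := K ∙ x k
    calc X * (W + W * Y * W) * X
        = X * W * X + X * W * Y * (W * X) := by simp only [mul_add, add_mul, mul_assoc]
      _ = W * (X * X) + W * (X * Y * X) * W := by rw [← hcomm, hcomm]; simp only [mul_assoc, hcomm]
      _ ≤ W * X * 1 + W * X * W := by
        grw [h.span_mul_span_le (by omega) hin, h.span_mul_span_mul_span_le hk hin, mul_one]
      _ ≤ W' * X * W' + W' * X * W' := by gcongr
      _ = W' * X * W' := add_idem _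

theorem wordAlg_succ_le (h : IsTLChain δ q x n) (hi₁ : 1 ≤ hi) (hin : hi ≤ n) :
    (wordAlg K x 1 (hi + 1)).toSubmodule ≤
      (wordAlg K x 1 hi).toSubmodule + bispan (wordAlg K x 1 hi) (x hi) := by
  rw [wordAlg_succ hi₁]
  exact toSubmodule_adjoin_insert_le (h.span_mul_wordAlg_mul_span_le hi₁ hin)

theorem wordAlg_succ_le_mul_add_mul_descProd (h : IsTLChain δ q x n) (hi₁ : 1 ≤ hi)
    (hin : hi ≤ n) :
    (wordAlg K x 1 (hi + 1)).toSubmodule ≤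
      (wordAlg K x 1 hi).toSubmodule * (wordAlg K x 2 (hi + 1)).toSubmodule +
        (wordAlg K x 1 hi).toSubmodule * (K ∙ descProd x 1 (hi + 1)) := by
  induction hi, hi₁ using Nat.le_induction with
  | base =>
    simpa [wordAlg_of_le, toSubmodule_bot, bispan, descProd_self_succ] using
      h.wordAlg_succ_le le_rfl hin
  | succ k hk ih =>
    have hstep := h.wordAlg_succ_le (hi := k + 1) (by omega) hin
    have hcomm := h.span_mul_wordAlg_comm k.lt_add_one hin
    have hW : (wordAlg K x 1 k).toSubmodule ≤ (wordAlg K x 1 (k + 1)).toSubmodule :=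
      wordAlg_mono le_rfl k.le_succ
    have hV : (K ∙ x (k + 1)) * (wordAlg K x 2 (k + 1)).toSubmodule ≤
        (wordAlg K x 2 (k + 2)).toSubmodule := span_mul_wordAlg_le (by omega)
    have hV₁ := one_le_toSubmodule (wordAlg K x 2 (k + 2))
    have hdesc : (K ∙ x (k + 1)) * (K ∙ descProd x 1 (k + 1)) = K ∙ descProd x 1 (k + 2) := by
      rw [span_singleton_mul_span_singleton, ← descProd_succ (by omega)]
    have hidem := (wordAlg K x 1 (k + 1)).isIdempotentElem_toSubmodule.eq
    have ih := ih (by omega)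
    rw [bispan] at hstep
    set W := (wordAlg K x 1 k).toSubmodule
    set W' := (wordAlg K x 1 (k + 1)).toSubmodule
    set V := (wordAlg K x 2 (k + 1)).toSubmodule
    set V' := (wordAlg K x 2 (k + 2)).toSubmodule
    set X := K ∙ x (k + 1)
    have hWXW : W' * X * W' ≤ W' * V' + W' * (K ∙ descProd x 1 (k + 2)) := by
      calc W' * X * W' ≤ W' * X * (W * V + W * (K ∙ descProd x 1 (k + 1))) := by gcongr
        _ = W' * (X * W) * V + W' * (X * W) * (K ∙ descProd x 1 (k + 1)) := by
          simp only [mul_add, mul_assoc]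
        _ = W' * W * (X * V) + W' * W * (K ∙ descProd x 1 (k + 2)) := by
          rw [hcomm, ← hdesc]; simp only [mul_assoc]
        _ ≤ W' * W' * V' + W' * W' * (K ∙ descProd x 1 (k + 2)) := by gcongr
        _ = W' * V' + W' * (K ∙ descProd x 1 (k + 2)) := by rw [hidem]
    exact hstep.trans (add_le ((le_mul_of_one_le_right' hV₁).trans le_self_add) hWXW)

end IsTLChain

end Chain

section Cycle

variable {K R : Type*} [CommSemiring K] [Semiring R] [Algebra K R]

open Submodule Algebra

/-- The relations of the Temperley–Lieb algebra of affine type `A`, for `x 0, …, x n` arranged in a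
cycle, in the same normalisation as `IsTLChain`. -/
structure IsTLCycle (δ q : K) (x : ℕ → R) (n : ℕ) : Prop where
  two_le : 2 ≤ n
  mul_self : ∀ i, i ≤ n → x i * x i = δ • x i
  mul_mul : ∀ i j, i ≤ n → j ≤ n →
    (j = i + 1 ∨ i = j + 1 ∨ (i = 0 ∧ j = n) ∨ (i = n ∧ j = 0)) → x i * x j * x i = q • x i
  commute : ∀ i j, i + 2 ≤ j → j ≤ n → ¬(i = 0 ∧ j = n) → Commute (x i) (x j)

variable (K) in
/-- The span of the words in `x 0, …, x n` with at most one letter among `x 0` and `x n`. -/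
def shortSpan (x : ℕ → R) (n : ℕ) : Submodule K R :=
  (wordAlg K x 1 n).toSubmodule + bispan (wordAlg K x 1 n) (x 0) + bispan (wordAlg K x 1 n) (x n)

variable (K) in
/-- The line spanned by the tour `x n ⋯ x 1 x 0`, which uses each letter of the cycle once. -/
def tourLine (x : ℕ → R) (n : ℕ) : Submodule K R :=
  K ∙ descProd x 0 (n + 1)

variable (K) in
/-- The span of the short words, the tour, and the words in which a single `x n * x 0` is the only
occurrence of the end letters. -/
def tourSpan (x : ℕ → R) (n : ℕ) : Submodule K R :=
  bispan (wordAlg K x 1 n) (x n * x 0) + tourLine K x n + shortSpan K x n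

variable {δ q : K} {x : ℕ → R} {i n k : ℕ}

theorem toSubmodule_le_shortSpan : (wordAlg K x 1 n).toSubmodule ≤ shortSpan K x n :=
  le_self_add.trans le_self_add

theorem bispan_first_le_shortSpan : bispan (wordAlg K x 1 n) (x 0) ≤ shortSpan K x n :=
  le_add_self.trans le_self_add

theorem bispan_last_le_shortSpan : bispan (wordAlg K x 1 n) (x n) ≤ shortSpan K x n :=
  le_add_self

theorem bispan_le_tourSpan : bispan (wordAlg K x 1 n) (x n * x 0) ≤ tourSpan K x n :=
  le_self_add.trans le_self_add

theorem tourLine_le_tourSpan : tourLine K x n ≤ tourSpan K x n :=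
  le_add_self.trans le_self_add

theorem shortSpan_le_tourSpan : shortSpan K x n ≤ tourSpan K x n :=
  le_add_self

theorem tourLine_eq_mul (hn : 1 ≤ n) :
    tourLine K x n = (K ∙ x n) * (K ∙ descProd x 1 n) * (K ∙ x 0) := by
  rw [tourLine, descProd_succ n.zero_le, descProd_zero hn, ← mul_assoc,
    span_singleton_mul_span_singleton, span_singleton_mul_span_singleton]

theorem span_descProd_le_toSubmodule {j : ℕ} (hi : 1 ≤ i) (hj : j ≤ n) :
    (K ∙ descProd x i j) ≤ (wordAlg K x 1 n).toSubmodule :=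
  span_singleton_le_toSubmodule (descProd_mem fun l hl hl' ↦ mem_wordAlg (by omega) (by omega))

theorem one_le_shortSpan : 1 ≤ shortSpan K x n :=
  (one_le_toSubmodule _).trans toSubmodule_le_shortSpan

theorem toSubmodule_mul_shortSpan :
    (wordAlg K x 1 n).toSubmodule * shortSpan K x n = shortSpan K x n := by
  simp only [shortSpan, mul_add, toSubmodule_mul_bispan,
    (Subalgebra.isIdempotentElem_toSubmodule _).eq]

theorem shortSpan_mul_toSubmodule :
    shortSpan K x n * (wordAlg K x 1 n).toSubmodule = shortSpan K x n := by
  simp only [shortSpan, add_mul, bispan_mul_toSubmodule,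
    (Subalgebra.isIdempotentElem_toSubmodule _).eq]

theorem wordAlg_reverse (x : ℕ → R) (n : ℕ) :
    wordAlg K (fun i ↦ x (n - i)) 1 n = wordAlg K x 1 n := by
  unfold wordAlg
  congr 1
  ext y
  constructor <;> rintro ⟨i, ⟨hi₁, hi₂⟩, rfl⟩ <;>
    exact ⟨n - i, ⟨by omega, by omega⟩, by simp [Nat.sub_sub_self hi₂.le]⟩

namespace IsTLCycle

theorem isTLChain (h : IsTLCycle δ q x n) : IsTLChain δ q x n where
  mul_self i _ hi := h.mul_self i hi
  mul_mul i j _ hi _ hj hij := h.mul_mul i j hi hj (by omega)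
  commute i j hi hij hj := h.commute i j hij hj (by omega)

theorem reverse (h : IsTLCycle δ q x n) : IsTLCycle δ q (fun i ↦ x (n - i)) n where
  two_le := h.two_le
  mul_self i _ := h.mul_self _ (n.sub_le i)
  mul_mul i j hi hj hij := h.mul_mul _ _ (n.sub_le i) (n.sub_le j) (by omega)
  commute i j hij hj h0 := (h.commute (n - j) (n - i) (by omega) (n.sub_le i) (by omega)).symm

theorem bispan_last_mul_self_le (h : IsTLCycle δ q x n) :
    bispan (wordAlg K x 1 n) (x n) * bispan (wordAlg K x 1 n) (x n) ≤
      bispan (wordAlg K x 1 n) (x n) :=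
  bispan_mul_bispan_le
    (h.isTLChain.span_mul_wordAlg_mul_span_le (one_le_two.trans h.two_le) le_rfl)
    toSubmodule_mul_bispan.le bispan_mul_toSubmodule.le

theorem bispan_first_mul_self_le (h : IsTLCycle δ q x n) :
    bispan (wordAlg K x 1 n) (x 0) * bispan (wordAlg K x 1 n) (x 0) ≤
      bispan (wordAlg K x 1 n) (x 0) := by
  simpa [wordAlg_reverse] using h.reverse.bispan_last_mul_self_le

theorem shortSpan_sq_le (h : IsTLCycle δ q x n) :
    shortSpan K x n ^ 2 ≤
      bispan (wordAlg K x 1 n) (x 0) * bispan (wordAlg K x 1 n) (x n) +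
        bispan (wordAlg K x 1 n) (x n) * bispan (wordAlg K x 1 n) (x 0) + shortSpan K x n := by
  have hP := h.bispan_first_mul_self_le
  have hQ := h.bispan_last_mul_self_le
  have hPE := bispan_first_le_shortSpan (K := K) (x := x) (n := n)
  have hQE := bispan_last_le_shortSpan (K := K) (x := x) (n := n)
  have hUE := toSubmodule_mul_shortSpan (K := K) (x := x) (n := n)
  have hPU := bispan_mul_toSubmodule (U := wordAlg K x 1 n) (x := x 0)
  have hQU := bispan_mul_toSubmodule (U := wordAlg K x 1 n) (x := x n)
  have hE : shortSpan K x n = _ + _ + _ := rfl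
  set P := bispan (wordAlg K x 1 n) (x 0)
  set Q := bispan (wordAlg K x 1 n) (x n)
  set U := (wordAlg K x 1 n).toSubmodule
  set E := shortSpan K x n
  calc E ^ 2 = U * E + P * E + Q * E := by rw [sq, ← add_mul, ← add_mul, ← hE]
    _ = E + (P + P * P + P * Q) + (Q + Q * P + Q * Q) := by
      rw [hUE, hE]; simp only [mul_add, hPU, hQU]
    _ ≤ E + (E + E + P * Q) + (E + Q * P + E) := by gcongr <;> order
    _ = P * Q + Q * P + E := by simp only [Submodule.add_eq_sup]; ac_nf

theorem shortSpan_pow_le (h : IsTLCycle δ q x n) (k : ℕ) :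
    shortSpan K x n ^ (2 * k + 2) ≤
      (bispan (wordAlg K x 1 n) (x 0) * bispan (wordAlg K x 1 n) (x n)) ^ (k + 1) +
        (bispan (wordAlg K x 1 n) (x n) * bispan (wordAlg K x 1 n) (x 0)) ^ (k + 1) +
        shortSpan K x n ^ (2 * k + 1) := by
  have hP := h.bispan_first_mul_self_le
  have hQ := h.bispan_last_mul_self_le
  have hPE := bispan_first_le_shortSpan (K := K) (x := x) (n := n)
  have hQE := bispan_last_le_shortSpan (K := K) (x := x) (n := n)
  have hsq := h.shortSpan_sq_le
  set P := bispan (wordAlg K x 1 n) (x 0)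
  set Q := bispan (wordAlg K x 1 n) (x n)
  set E := shortSpan K x n
  rw [show 2 * k + 2 = 2 * (k + 1) by ring, pow_mul]
  refine pow_succ_le_pow_add_pow_add one_le_shortSpan ?_ ?_ ?_ ?_ hsq k
  · grw [hPE, hQE, sq]
  · grw [hPE, hQE, sq]
  · exact (mul_mul_mul_le_pow_three hPE hQE hQ).trans le_add_self
  · exact (mul_mul_mul_le_pow_three hQE hPE hP).trans le_add_self

theorem descProd_mul_descProd_zero (h : IsTLCycle δ q x n) (hi₁ : 1 ≤ i) (hin : i + 1 ≤ n) :
    descProd x (i + 1) (n + 1) * descProd x 0 i =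
      descProd x 1 i * (x n * x 0) * descProd x (i + 1) n := by
  have hfirst : Commute (x 0) (descProd x (i + 1) n) :=
    commute_descProd fun l hl hl' ↦ h.commute 0 l (by omega) (by omega) (by omega)
  have hlast : Commute (x n) (descProd x 1 i) :=
    commute_descProd fun l hl hl' ↦ (h.commute l n (by omega) le_rfl (by omega)).symm
  have hmid : Commute (descProd x (i + 1) n) (descProd x 1 i) :=
    commute_descProd fun l hl hl' ↦ .symm <| commute_descProd fun m hm hm' ↦
      h.commute l m (by omega) (by omega) (by omega)
  calc descProd x (i + 1) (n + 1) * descProd x 0 i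
      = x n * (descProd x (i + 1) n * descProd x 1 i) * x 0 := by
        rw [descProd_succ hin, descProd_zero hi₁]; simp only [mul_assoc]
    _ = x n * descProd x 1 i * (descProd x (i + 1) n * x 0) := by
        rw [hmid.eq]; simp only [mul_assoc]
    _ = descProd x 1 i * (x n * x 0) * descProd x (i + 1) n := by
        rw [hlast.eq, ← hfirst.eq]; simp only [mul_assoc]

theorem span_descProd_mul_descProd_zero_le (h : IsTLCycle δ q x n) (hi : i ≤ n) :
    (K ∙ (descProd x (i + 1) (n + 1) * descProd x 0 i)) ≤ tourSpan K x n := by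
  have hn := h.two_le
  rcases Nat.eq_zero_or_pos i with rfl | hi₁
  · grw [descProd_self, mul_one, descProd_succ (by omega), ← span_singleton_mul_span_singleton,
      span_descProd_le_toSubmodule le_rfl le_rfl,
      span_singleton_le_bispan (U := wordAlg K x 1 n), bispan_mul_toSubmodule,
      bispan_last_le_shortSpan, shortSpan_le_tourSpan]
  rcases hi.eq_or_lt with rfl | hin
  · grw [descProd_self, one_mul, descProd_zero hi₁, ← span_singleton_mul_span_singleton,
      span_descProd_le_toSubmodule le_rfl le_rfl,
      span_singleton_le_bispan (U := wordAlg K x 1 i) (x := x 0), toSubmodule_mul_bispan,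
      bispan_first_le_shortSpan, shortSpan_le_tourSpan]
  · grw [h.descProd_mul_descProd_zero hi₁ hin, ← span_singleton_mul_span_singleton,
      ← span_singleton_mul_span_singleton, span_descProd_le_toSubmodule le_rfl hi,
      span_descProd_le_toSubmodule (by omega) le_rfl]
    exact bispan_le_tourSpan

theorem mul_tour (h : IsTLCycle δ q x n) (hi₁ : 1 ≤ i) (hi₂ : i + 1 ≤ n) :
    x i * descProd x 0 (n + 1) = q • (descProd x (i + 2) (n + 1) * descProd x 0 (i + 1)) := by
  have hcomm : Commute (x i) (descProd x (i + 2) (n + 1)) :=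
    commute_descProd fun l hl hl' ↦ h.commute i l hl (by omega) (by omega)
  calc x i * descProd x 0 (n + 1)
      = x i * (descProd x (i + 2) (n + 1) * (x (i + 1) * (x i * descProd x 0 i))) := by
        rw [← descProd_succ i.zero_le, ← descProd_succ (i + 1).zero_le,
          descProd_mul_descProd (by omega) (by omega)]
    _ = descProd x (i + 2) (n + 1) * (x i * x (i + 1) * x i * descProd x 0 i) := by
        rw [← mul_assoc, hcomm.eq]; simp only [mul_assoc]
    _ = q • (descProd x (i + 2) (n + 1) * descProd x 0 (i + 1)) := by
        rw [h.mul_mul i (i + 1) (by omega) hi₂ (Or.inl rfl), smul_mul_assoc, mul_smul_comm,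
          ← descProd_succ i.zero_le]

theorem tour_mul (h : IsTLCycle δ q x n) (hi : i + 2 ≤ n) :
    descProd x 0 (n + 1) * x (i + 1) = q • (descProd x (i + 1) (n + 1) * descProd x 0 i) := by
  have hcomm : Commute (x (i + 1)) (descProd x 0 i) :=
    commute_descProd fun l _ hl' ↦ (h.commute l (i + 1) (by omega) (by omega) (by omega)).symm
  calc descProd x 0 (n + 1) * x (i + 1)
      = descProd x (i + 2) (n + 1) * (x (i + 1) * (x i * descProd x 0 i)) * x (i + 1) := by
        rw [← descProd_succ i.zero_le, ← descProd_succ (i + 1).zero_le,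
          descProd_mul_descProd (by omega) (by omega)]
    _ = descProd x (i + 2) (n + 1) * (x (i + 1) * x i * x (i + 1)) * descProd x 0 i := by
        simp only [mul_assoc, hcomm.eq]
    _ = q • (descProd x (i + 1) (n + 1) * descProd x 0 i) := by
        rw [h.mul_mul (i + 1) i (by omega) (by omega) (by omega), mul_smul_comm, smul_mul_assoc,
          ← descProd_self_succ (x := x) (i := i + 1),
          descProd_mul_descProd (by omega) (by omega)]

theorem toSubmodule_mul_tourSpan_le (h : IsTLCycle δ q x n) :
    (wordAlg K x 1 n).toSubmodule * tourSpan K x n ≤ tourSpan K x n := by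
  refine adjoin_mul_le le_rfl ?_
  rintro _ ⟨i, hi, rfl⟩
  have hxU := span_singleton_le_toSubmodule (K := K) (mem_wordAlg hi.1 hi.2 : x i ∈ _)
  have htour : (K ∙ x i) * tourLine K x n ≤ tourSpan K x n := by
    rw [tourLine, span_singleton_mul_span_singleton, h.mul_tour hi.1 hi.2]
    exact (span_singleton_smul_le K q _).trans (h.span_descProd_mul_descProd_zero_le hi.2)
  conv_lhs => rw [tourSpan, mul_add, mul_add]
  refine add_le (add_le ?_ htour) ?_
  · grw [hxU, toSubmodule_mul_bispan, bispan_le_tourSpan]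
  · grw [hxU, toSubmodule_mul_shortSpan, shortSpan_le_tourSpan]

theorem tourSpan_mul_toSubmodule_le (h : IsTLCycle δ q x n) :
    tourSpan K x n * (wordAlg K x 1 n).toSubmodule ≤ tourSpan K x n := by
  refine mul_adjoin_le le_rfl ?_
  rintro _ ⟨i, hi, rfl⟩
  have hxU := span_singleton_le_toSubmodule (K := K) (mem_wordAlg hi.1 hi.2 : x i ∈ _)
  have htour : tourLine K x n * (K ∙ x i) ≤ tourSpan K x n := by
    obtain ⟨i, rfl⟩ := Nat.exists_eq_add_of_le' hi.1
    have hin := hi.2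
    rw [tourLine, span_singleton_mul_span_singleton, h.tour_mul hin]
    exact (span_singleton_smul_le K q _).trans (h.span_descProd_mul_descProd_zero_le (by omega))
  conv_lhs => rw [tourSpan, add_mul, add_mul]
  refine add_le (add_le ?_ htour) ?_
  · grw [hxU, bispan_mul_toSubmodule, bispan_le_tourSpan]
  · grw [hxU, shortSpan_mul_toSubmodule, shortSpan_le_tourSpan]

theorem span_first_mul_wordAlg_comm (h : IsTLCycle δ q x n) :
    (K ∙ x 0) * (wordAlg K x 2 n).toSubmodule = (wordAlg K x 2 n).toSubmodule * (K ∙ x 0) := by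
  refine span_singleton_mul_adjoin_comm ?_
  rintro _ ⟨i, ⟨hi, hi'⟩, rfl⟩
  exact h.commute 0 i (by omega) (by omega) (by omega)

theorem span_last_mul_toSubmodule_mul_span_first_le (h : IsTLCycle δ q x n) :
    (K ∙ x n) * (wordAlg K x 1 n).toSubmodule * (K ∙ x 0) ≤ tourSpan K x n := by
  obtain ⟨m, rfl⟩ : ∃ m, n = m + 1 := Nat.exists_eq_add_of_le' (one_le_two.trans h.two_le)
  have hm := h.two_le
  have hnormal := h.isTLChain.wordAlg_succ_le_mul_add_mul_descProd (hi := m) (by omega) m.le_succ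
  have hlast := h.isTLChain.span_mul_wordAlg_comm m.lt_add_one le_rfl
  have hfirst := h.span_first_mul_wordAlg_comm
  have htour := tourLine_eq_mul (K := K) (x := x) (n := m + 1) (by omega)
  have htourM := tourLine_le_tourSpan (K := K) (x := x) (n := m + 1)
  have hG : (wordAlg K x 1 (m + 1)).toSubmodule * ((K ∙ x (m + 1)) * (K ∙ x 0)) *
      (wordAlg K x 1 (m + 1)).toSubmodule ≤ tourSpan K x (m + 1) := by
    rw [span_singleton_mul_span_singleton]
    exact bispan_le_tourSpan
  have hUM := h.toSubmodule_mul_tourSpan_le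
  have hW : (wordAlg K x 1 m).toSubmodule ≤ (wordAlg K x 1 (m + 1)).toSubmodule :=
    wordAlg_mono le_rfl m.le_succ
  have hV : (wordAlg K x 2 (m + 1)).toSubmodule ≤ (wordAlg K x 1 (m + 1)).toSubmodule :=
    wordAlg_mono one_le_two le_rfl
  set U := (wordAlg K x 1 (m + 1)).toSubmodule
  set W := (wordAlg K x 1 m).toSubmodule
  set V := (wordAlg K x 2 (m + 1)).toSubmodule
  set T := tourSpan K x (m + 1)
  calc (K ∙ x (m + 1)) * U * (K ∙ x 0)
      ≤ (K ∙ x (m + 1)) * (W * V + W * (K ∙ descProd x 1 (m + 1))) * (K ∙ x 0) := by gcongr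
    _ = (K ∙ x (m + 1)) * W * (V * (K ∙ x 0)) +
        (K ∙ x (m + 1)) * W * (K ∙ descProd x 1 (m + 1)) * (K ∙ x 0) := by
      simp only [mul_add, add_mul, mul_assoc]
    _ = W * ((K ∙ x (m + 1)) * (K ∙ x 0)) * V + W * tourLine K x (m + 1) := by
      rw [hlast, ← hfirst, htour]; simp only [mul_assoc]
    _ ≤ U * ((K ∙ x (m + 1)) * (K ∙ x 0)) * U + U * T := by gcongr
    _ ≤ T := add_le hG hUM

theorem bispan_last_mul_bispan_first_le_tourSpan (h : IsTLCycle δ q x n) :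
    bispan (wordAlg K x 1 n) (x n) * bispan (wordAlg K x 1 n) (x 0) ≤ tourSpan K x n :=
  bispan_mul_bispan_le h.span_last_mul_toSubmodule_mul_span_first_le
    h.toSubmodule_mul_tourSpan_le h.tourSpan_mul_toSubmodule_le

theorem tourLine_le_shortSpan_sq (h : IsTLCycle δ q x n) :
    tourLine K x n ≤ shortSpan K x n ^ 2 := by
  grw [tourLine_eq_mul (one_le_two.trans h.two_le), span_descProd_le_toSubmodule le_rfl le_rfl,
    span_singleton_le_bispan (U := wordAlg K x 1 n), bispan_mul_toSubmodule,
    span_singleton_le_bispan (U := wordAlg K x 1 n) (x := x 0),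
    bispan_first_le_shortSpan, bispan_last_le_shortSpan, sq]

theorem last_mul_first_mul_tour (h : IsTLCycle δ q x n) :
    x n * x 0 * descProd x 0 (n + 1) = q • descProd x 0 (n + 1) := by
  rw [descProd_succ n.zero_le, ← mul_assoc, h.mul_mul n 0 le_rfl n.zero_le (by simp),
    smul_mul_assoc]

theorem tour_mul_last_mul_first (h : IsTLCycle δ q x n) :
    descProd x 0 (n + 1) * (x n * x 0) = q • descProd x 0 (n + 1) := by
  rw [descProd_zero (by omega), mul_assoc, ← mul_assoc (x 0),
    h.mul_mul 0 n n.zero_le le_rfl (by simp), mul_smul_comm]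

theorem bispan_last_mul_first_le_shortSpan_sq :
    bispan (wordAlg K x 1 n) (x n * x 0) ≤ shortSpan K x n ^ 2 := by
  grw [bispan_mul_le, bispan_first_le_shortSpan, bispan_last_le_shortSpan, sq]

theorem bispan_first_mul_last_le_shortSpan_sq :
    bispan (wordAlg K x 1 n) (x 0 * x n) ≤ shortSpan K x n ^ 2 := by
  grw [bispan_mul_le, bispan_first_le_shortSpan, bispan_last_le_shortSpan, sq]

theorem bispan_mul_tourLine_le (h : IsTLCycle δ q x n) :
    bispan (wordAlg K x 1 n) (x n * x 0) * tourLine K x n ≤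
      bispan (wordAlg K x 1 n) (x n * x 0) ^ 2 + shortSpan K x n ^ 3 := by
  refine mul_le_sq_add_pow_three (one_le_toSubmodule _) one_le_shortSpan ?_ ?_
    bispan_last_mul_first_le_shortSpan_sq h.tourLine_le_shortSpan_sq
  · rw [tourLine, span_singleton_mul_span_singleton, h.last_mul_first_mul_tour]
    exact span_singleton_smul_le K q _
  · exact (mul_le_mul_right tourLine_le_tourSpan _).trans h.toSubmodule_mul_tourSpan_le

theorem tourLine_mul_bispan_le (h : IsTLCycle δ q x n) :
    tourLine K x n * bispan (wordAlg K x 1 n) (x n * x 0) ≤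
      bispan (wordAlg K x 1 n) (x n * x 0) ^ 2 + shortSpan K x n ^ 3 := by
  refine mul_le_sq_add_pow_three' (one_le_toSubmodule _) one_le_shortSpan ?_ ?_
    bispan_last_mul_first_le_shortSpan_sq h.tourLine_le_shortSpan_sq
  · rw [tourLine, span_singleton_mul_span_singleton, h.tour_mul_last_mul_first]
    exact span_singleton_smul_le K q _
  · exact (mul_le_mul_left tourLine_le_tourSpan _).trans h.tourSpan_mul_toSubmodule_le

theorem bispan_last_mul_bispan_first_pow_le (h : IsTLCycle δ q x n) (k : ℕ) :
    (bispan (wordAlg K x 1 n) (x n) * bispan (wordAlg K x 1 n) (x 0)) ^ (k + 1) ≤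
      bispan (wordAlg K x 1 n) (x n * x 0) ^ (k + 1) + tourLine K x n ^ (k + 1) +
        shortSpan K x n ^ (2 * k + 1) :=
  pow_succ_le_pow_add_pow_add one_le_shortSpan bispan_last_mul_first_le_shortSpan_sq
    h.tourLine_le_shortSpan_sq h.bispan_mul_tourLine_le h.tourLine_mul_bispan_le
    h.bispan_last_mul_bispan_first_le_tourSpan k

end IsTLCycle

end Cycle

section Trace

variable {K R M : Type*} [CommSemiring K] [Semiring R] [Algebra K R] [AddCommMonoid M] [Module K M]

open Submodule

variable {τ : R →ₗ[K] M} {X Y : Submodule K R}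

theorem mul_le_ker_comm (hτ : ∀ x y, τ (x * y) = τ (y * x)) (h : X * Y ≤ LinearMap.ker τ) :
    Y * X ≤ LinearMap.ker τ :=
  mul_le.2 fun y hy x hx ↦ by
    simpa only [LinearMap.mem_ker, hτ y x] using h (mul_mem_mul hx hy)

theorem mul_pow_le_ker_comm (hτ : ∀ x y, τ (x * y) = τ (y * x)) {k : ℕ}
    (h : (X * Y) ^ (k + 1) ≤ LinearMap.ker τ) : (Y * X) ^ (k + 1) ≤ LinearMap.ker τ := by
  rw [pow_succ, ← mul_assoc, mul_pow_mul]
  refine mul_le_ker_comm hτ ?_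
  rwa [← mul_assoc, ← pow_succ']

theorem mul_pow_mul_add_le_ker (hτ : ∀ x y, τ (x * y) = τ (y * x)) (hX : X * X ≤ X)
    (hY : Y * Y ≤ Y) {k : ℕ} (h : (X * Y) ^ (k + 1) ≤ LinearMap.ker τ) :
    (X * Y) ^ (k + 1) * (X + Y) ≤ LinearMap.ker τ := by
  rw [mul_add]
  refine add_le (mul_le_ker_comm hτ ?_) ?_
  · calc X * (X * Y) ^ (k + 1) = X * X * Y * (X * Y) ^ k := by rw [pow_succ']; simp only [mul_assoc]
      _ ≤ (X * Y) ^ (k + 1) := by rw [pow_succ']; gcongr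
      _ ≤ LinearMap.ker τ := h
  · calc (X * Y) ^ (k + 1) * Y = (X * Y) ^ k * (X * (Y * Y)) := by
          rw [pow_succ]; simp only [mul_assoc]
      _ ≤ (X * Y) ^ (k + 1) := by rw [pow_succ]; gcongr
      _ ≤ LinearMap.ker τ := h

end Trace

section BraidConj

variable {K R : Type*} [CommRing K] [Ring R] [Algebra K R]

open Submodule

variable {q : Kˣ} {a b : R} {U S : Subalgebra K R}

/-- The element `h * g * h⁻¹ + 1`, written in terms of `a = g + 1` and `b = h + 1` for generators
`g`, `h` subject to the Temperley–Lieb relations with parameter `q`. -/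
def braidConj (q : Kˣ) (b a : R) : R :=
  b + a - b * a - (↑q⁻¹ : K) • (a * b)

theorem mul_braidConj (hb : b * b = ((q : K) + 1) • b) (hbab : b * a * b = (q : K) • b) :
    b * braidConj q b a = (q : K) • (b - b * a) := by
  calc b * braidConj q b a = b * b + b * a - b * b * a - (↑q⁻¹ : K) • (b * a * b) := by
        simp only [braidConj, mul_sub, mul_add, mul_smul_comm, mul_assoc]
    _ = (q : K) • (b - b * a) := by
        rw [hb, hbab, smul_smul, Units.inv_mul, one_smul, smul_mul_assoc]; module

theorem braidConj_mul (hb : b * b = ((q : K) + 1) • b) (hbab : b * a * b = (q : K) • b) :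
    braidConj q b a * b = b - (↑q⁻¹ : K) • (a * b) := by
  calc braidConj q b a * b = b * b + a * b - b * a * b - (↑q⁻¹ : K) • (a * (b * b)) := by
        simp only [braidConj, sub_mul, add_mul, smul_mul_assoc, mul_assoc]
    _ = b - (↑q⁻¹ : K) • (a * b) := by
        rw [hb, hbab, mul_smul_comm, smul_smul, mul_add, Units.inv_mul]; module

theorem bispan_mul_le_bispan_left (hb : b * b = ((q : K) + 1) • b)
    (hbab : b * a * b = (q : K) • b) (hc : braidConj q b a ∈ S) :
    bispan S (b * a) ≤ bispan S b := by
  have hba : b * a = b * (1 - (↑q⁻¹ : K) • braidConj q b a) := by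
    rw [mul_sub, mul_one, mul_smul_comm, mul_braidConj hb hbab, smul_smul, Units.inv_mul]; module
  have hmem : 1 - (↑q⁻¹ : K) • braidConj q b a ∈ S := sub_mem (one_mem S) (S.smul_mem hc _)
  refine bispan_le ?_ toSubmodule_mul_bispan.le bispan_mul_toSubmodule.le
  grw [hba, ← span_singleton_mul_span_singleton, span_singleton_le_toSubmodule hmem,
    span_singleton_le_bispan (U := S) (x := b), bispan_mul_toSubmodule]

theorem bispan_mul_le_bispan_right (hb : b * b = ((q : K) + 1) • b)
    (hbab : b * a * b = (q : K) • b) (hc : braidConj q b a ∈ S) :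
    bispan S (a * b) ≤ bispan S b := by
  have hab : a * b = (q : K) • (1 - braidConj q b a) * b := by
    rw [smul_mul_assoc, sub_mul, one_mul, braidConj_mul hb hbab, sub_sub_cancel, smul_smul,
      Units.mul_inv, one_smul]
  have hmem : (q : K) • (1 - braidConj q b a) ∈ S := S.smul_mem (sub_mem (one_mem S) hc) _
  refine bispan_le ?_ toSubmodule_mul_bispan.le bispan_mul_toSubmodule.le
  grw [hab, ← span_singleton_mul_span_singleton, span_singleton_le_toSubmodule hmem,
    span_singleton_le_bispan (U := S) (x := b), toSubmodule_mul_bispan]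

theorem bispan_le_toSubmodule_add_bispan (hb : b * b = ((q : K) + 1) • b)
    (hbab : b * a * b = (q : K) • b) (hc : braidConj q b a ∈ S) :
    bispan S a ≤ S.toSubmodule + bispan S b := by
  refine bispan_le ((span_singleton_le_iff_mem _ _).2 ?_) ?_ ?_
  · have ha : a = braidConj q b a + (b * a + (↑q⁻¹ : K) • (a * b) - b) := by
      rw [braidConj]; abel
    rw [ha]
    exact add_mem_sup hc (sub_mem (add_mem (bispan_mul_le_bispan_left hb hbab hc mem_bispan_self)
      (smul_mem _ _ (bispan_mul_le_bispan_right hb hbab hc mem_bispan_self))) mem_bispan_self)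
  · rw [mul_add, S.isIdempotentElem_toSubmodule.eq, toSubmodule_mul_bispan]
  · rw [add_mul, S.isIdempotentElem_toSubmodule.eq, bispan_mul_toSubmodule]

theorem bispan_mul_le_bispan_braidConj_add :
    bispan U (b * a) ≤
      bispan U (braidConj q b a) + bispan U (a * b) + (bispan U a + bispan U b) := by
  refine bispan_le ((span_singleton_le_iff_mem _ _).2 ?_) ?_ ?_
  · have hba : b * a = -braidConj q b a + -(↑q⁻¹ : K) • (a * b) + (a + b) := by
      rw [braidConj]; module
    rw [hba]
    exact add_mem_sup (add_mem_sup (neg_mem mem_bispan_self) (smul_mem _ _ mem_bispan_self))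
      (add_mem_sup mem_bispan_self mem_bispan_self)
  · simp only [mul_add, toSubmodule_mul_bispan, le_refl]
  · simp only [add_mul, bispan_mul_toSubmodule, le_refl]

theorem bispan_mul_swap_le_bispan_braidConj_add :
    bispan U (a * b) ≤
      bispan U (braidConj q b a) + bispan U (b * a) + (bispan U a + bispan U b) := by
  refine bispan_le ((span_singleton_le_iff_mem _ _).2 ?_) ?_ ?_
  · have hab : a * b = -(q : K) • braidConj q b a + -(q : K) • (b * a) +
        ((q : K) • a + (q : K) • b) := by
      have hsmul : (q : K) • (↑q⁻¹ : K) • (a * b) = a * b := by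
        rw [smul_smul, Units.mul_inv, one_smul]
      simp only [braidConj, smul_sub, smul_add, neg_smul, hsmul]; abel
    rw [hab]
    exact add_mem_sup (add_mem_sup (smul_mem _ _ mem_bispan_self) (smul_mem _ _ mem_bispan_self))
      (add_mem_sup (smul_mem _ _ mem_bispan_self) (smul_mem _ _ mem_bispan_self))
  · simp only [mul_add, toSubmodule_mul_bispan, le_refl]
  · simp only [add_mul, bispan_mul_toSubmodule, le_refl]

theorem bispan_braidConj_le :
    bispan U (braidConj q b a) ≤
      bispan U b * bispan U a + bispan U a * bispan U b + (bispan U a + bispan U b) := by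
  refine bispan_le ((span_singleton_le_iff_mem _ _).2 ?_) ?_ ?_
  · have hc : braidConj q b a = -(b * a) + -(↑q⁻¹ : K) • (a * b) + (a + b) := by
      rw [braidConj]; module
    rw [hc]
    exact add_mem_sup (add_mem_sup (neg_mem (mul_mem_mul mem_bispan_self mem_bispan_self))
      (smul_mem _ _ (mul_mem_mul mem_bispan_self mem_bispan_self)))
      (add_mem_sup mem_bispan_self mem_bispan_self)
  · simp only [mul_add, ← mul_assoc, toSubmodule_mul_bispan, le_refl]
  · simp only [add_mul, mul_assoc, bispan_mul_toSubmodule, le_refl]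

end BraidConj

namespace IsTLCycle

variable {K R M : Type*} [CommRing K] [Ring R] [Algebra K R] [AddCommGroup M] [Module K M]

open Submodule

variable {q : Kˣ} {x : ℕ → R} {i n k : ℕ} {S : Subalgebra K R} {τ : R →ₗ[K] M}

theorem bispan_braidConj_le_shortSpan_sq :
    bispan (wordAlg K x 1 n) (braidConj q (x n) (x 0)) ≤ shortSpan K x n ^ 2 := by
  calc bispan (wordAlg K x 1 n) (braidConj q (x n) (x 0))
      ≤ shortSpan K x n ^ 2 + shortSpan K x n := by
        grw [bispan_braidConj_le, bispan_first_le_shortSpan, bispan_last_le_shortSpan, ← sq,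
          add_idem, add_idem]
    _ ≤ shortSpan K x n ^ 2 := add_le le_rfl (le_self_pow₀ one_le_shortSpan two_ne_zero)

theorem mul_bispan_braidConj_pow_le (hU : wordAlg K x 1 n ≤ S)
    (hc : braidConj q (x n) (x 0) ∈ S) {y : R} (hy : bispan S y ≤ bispan S (x n)) :
    bispan (wordAlg K x 1 n) y * bispan (wordAlg K x 1 n) (braidConj q (x n) (x 0)) ^ k ≤
      bispan S (x n) := by
  have hstep : bispan S (x n) * bispan (wordAlg K x 1 n) (braidConj q (x n) (x 0)) ≤
      bispan S (x n) := by
    grw [bispan_mono hU, bispan_le_toSubmodule hc, bispan_mul_toSubmodule]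
  grw [bispan_mono (x := y) hU, hy]
  exact mul_pow_le_of_mul_le hstep k

theorem bispan_last_mul_first_pow_le (h : IsTLCycle ((q : K) + 1) (q : K) x n)
    (hU : wordAlg K x 1 n ≤ S) (hc : braidConj q (x n) (x 0) ∈ S) (k : ℕ) :
    bispan (wordAlg K x 1 n) (x n * x 0) ^ (k + 1) ≤
      bispan S (x n) + shortSpan K x n ^ (2 * k + 1) := by
  have hXY : bispan (wordAlg K x 1 n) (x n * x 0) * bispan (wordAlg K x 1 n) (x 0 * x n) ≤
      shortSpan K x n ^ 3 := by
    grw [bispan_mul_le, bispan_mul_le (x := x 0)]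
    exact mul_mul_mul_le_pow_three bispan_last_le_shortSpan bispan_first_le_shortSpan
      h.bispan_first_mul_self_le
  have hXC : bispan (wordAlg K x 1 n) (x n * x 0) ≤
      bispan (wordAlg K x 1 n) (braidConj q (x n) (x 0)) + bispan (wordAlg K x 1 n) (x 0 * x n) +
        shortSpan K x n := by
    grw [bispan_mul_le_bispan_braidConj_add (q := q), bispan_first_le_shortSpan,
      bispan_last_le_shortSpan, add_idem (shortSpan K x n)]
  grw [pow_succ_le_mul_pow_add bispan_last_mul_first_le_shortSpan_sq
    bispan_braidConj_le_shortSpan_sq hXC hXY k, mul_bispan_braidConj_pow_le hU hc]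
  exact bispan_mul_le_bispan_left (h.mul_self n le_rfl)
    (h.mul_mul n 0 le_rfl n.zero_le (by simp)) hc

theorem bispan_first_mul_last_pow_le (h : IsTLCycle ((q : K) + 1) (q : K) x n)
    (hU : wordAlg K x 1 n ≤ S) (hc : braidConj q (x n) (x 0) ∈ S) (k : ℕ) :
    bispan (wordAlg K x 1 n) (x 0 * x n) ^ (k + 1) ≤
      bispan S (x n) + shortSpan K x n ^ (2 * k + 1) := by
  have hXY : bispan (wordAlg K x 1 n) (x 0 * x n) * bispan (wordAlg K x 1 n) (x n * x 0) ≤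
      shortSpan K x n ^ 3 := by
    grw [bispan_mul_le, bispan_mul_le (x := x n)]
    exact mul_mul_mul_le_pow_three bispan_first_le_shortSpan bispan_last_le_shortSpan
      h.bispan_last_mul_self_le
  have hXC : bispan (wordAlg K x 1 n) (x 0 * x n) ≤
      bispan (wordAlg K x 1 n) (braidConj q (x n) (x 0)) + bispan (wordAlg K x 1 n) (x n * x 0) +
        shortSpan K x n := by
    grw [bispan_mul_swap_le_bispan_braidConj_add (q := q), bispan_last_le_shortSpan,
      bispan_first_le_shortSpan, add_idem (shortSpan K x n)]
  grw [pow_succ_le_mul_pow_add bispan_first_mul_last_le_shortSpan_sq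
    bispan_braidConj_le_shortSpan_sq hXC hXY k, mul_bispan_braidConj_pow_le hU hc]
  exact bispan_mul_le_bispan_right (h.mul_self n le_rfl)
    (h.mul_mul n 0 le_rfl n.zero_le (by simp)) hc

theorem tourLine_pow_le_ker (h : IsTLCycle ((q : K) + 1) (q : K) x n)
    (hτ : ∀ x y, τ (x * y) = τ (y * x))
    (hG : bispan (wordAlg K x 1 n) (x 0 * x n) ^ (k + 1) ≤ LinearMap.ker τ) :
    tourLine K x n ^ (k + 1) ≤ LinearMap.ker τ := by
  rw [tourLine_eq_mul (one_le_two.trans h.two_le), mul_assoc]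
  refine mul_pow_le_ker_comm hτ (le_trans ?_ hG)
  gcongr
  grw [mul_assoc, span_singleton_mul_span_singleton (x 0),
    span_descProd_le_toSubmodule le_rfl le_rfl,
    span_singleton_le_bispan (U := wordAlg K x 1 n) (x := x 0 * x n), toSubmodule_mul_bispan]

theorem bispan_last_mul_bispan_first_pow_le_ker (h : IsTLCycle ((q : K) + 1) (q : K) x n)
    (hU : wordAlg K x 1 n ≤ S) (hc : braidConj q (x n) (x 0) ∈ S)
    (hτ : ∀ x y, τ (x * y) = τ (y * x)) (hb : bispan S (x n) ≤ LinearMap.ker τ)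
    (hE : shortSpan K x n ^ (2 * k + 1) ≤ LinearMap.ker τ) :
    (bispan (wordAlg K x 1 n) (x n) * bispan (wordAlg K x 1 n) (x 0)) ^ (k + 1) ≤
      LinearMap.ker τ := by
  have hG := (h.bispan_last_mul_first_pow_le hU hc k).trans (add_le hb hE)
  have hG' := (h.bispan_first_mul_last_pow_le hU hc k).trans (add_le hb hE)
  exact (h.bispan_last_mul_bispan_first_pow_le k).trans
    (add_le (add_le hG (h.tourLine_pow_le_ker hτ hG')) hE)

theorem shortSpan_le_ker (h : IsTLCycle ((q : K) + 1) (q : K) x n)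
    (hU : wordAlg K x 1 n ≤ S) (hc : braidConj q (x n) (x 0) ∈ S)
    (hS : S.toSubmodule ≤ LinearMap.ker τ) (hb : bispan S (x n) ≤ LinearMap.ker τ) :
    shortSpan K x n ≤ LinearMap.ker τ := by
  refine add_le (add_le (le_trans hU hS) ?_) ((bispan_mono hU).trans hb)
  grw [bispan_mono hU, bispan_le_toSubmodule_add_bispan (h.mul_self n le_rfl)
    (h.mul_mul n 0 le_rfl n.zero_le (by simp)) hc]
  exact add_le hS hb

theorem shortSpan_pow_le_ker (h : IsTLCycle ((q : K) + 1) (q : K) x n)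
    (hU : wordAlg K x 1 n ≤ S) (hc : braidConj q (x n) (x 0) ∈ S)
    (hτ : ∀ x y, τ (x * y) = τ (y * x))
    (hS : S.toSubmodule ≤ LinearMap.ker τ) (hb : bispan S (x n) ≤ LinearMap.ker τ) (k : ℕ) :
    shortSpan K x n ^ (2 * k + 1) ≤ LinearMap.ker τ := by
  induction k with
  | zero => simpa using h.shortSpan_le_ker hU hc hS hb
  | succ k ih =>
    have hQP := h.bispan_last_mul_bispan_first_pow_le_ker hU hc hτ hb ih
    have hPQ := mul_pow_le_ker_comm hτ hQP
    have hE := (h.shortSpan_pow_le k).trans (add_le (add_le hPQ hQP) ih)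
    have hmul {Z : Submodule K R} (hZU : Z * (wordAlg K x 1 n).toSubmodule ≤ LinearMap.ker τ)
        (hZ : Z * (bispan (wordAlg K x 1 n) (x 0) + bispan (wordAlg K x 1 n) (x n)) ≤
          LinearMap.ker τ) : Z * shortSpan K x n ≤ LinearMap.ker τ := by
      rw [shortSpan, add_assoc, mul_add]
      exact add_le hZU hZ
    have hPQE := hmul (by rwa [pow_succ, mul_assoc, mul_assoc, bispan_mul_toSubmodule, ← pow_succ])
      (mul_pow_mul_add_le_ker hτ h.bispan_first_mul_self_le h.bispan_last_mul_self_le hPQ)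
    have hQPE := hmul (by rwa [pow_succ, mul_assoc, mul_assoc, bispan_mul_toSubmodule, ← pow_succ])
      (add_comm (bispan (wordAlg K x 1 n) (x n)) _ ▸
        mul_pow_mul_add_le_ker hτ h.bispan_last_mul_self_le h.bispan_first_mul_self_le hQP)
    rw [mul_add_one, pow_succ]
    grw [h.shortSpan_pow_le k]
    rw [add_mul, add_mul, ← pow_succ]
    exact add_le (add_le hPQE hQPE) hE

theorem self_mem_shortSpan (hi : i ≤ n) : x i ∈ shortSpan K x n := by
  rcases Nat.eq_zero_or_pos i with rfl | hi₀
  · exact bispan_first_le_shortSpan mem_bispan_self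
  rcases hi.eq_or_lt with rfl | hin
  · exact bispan_last_le_shortSpan mem_bispan_self
  · exact toSubmodule_le_shortSpan (mem_wordAlg hi₀ hin)

theorem eq_zero_of_adjoin_eq_top (h : IsTLCycle ((q : K) + 1) (q : K) x n)
    (hx : Algebra.adjoin K (x '' Set.Iic n) = ⊤)
    (hU : wordAlg K x 1 n ≤ S) (hc : braidConj q (x n) (x 0) ∈ S)
    (hτ : ∀ x y, τ (x * y) = τ (y * x))
    (hS : S.toSubmodule ≤ LinearMap.ker τ) (hb : bispan S (x n) ≤ LinearMap.ker τ) : τ = 0 := by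
  rw [← LinearMap.ker_eq_top, ← top_le_iff, ← Algebra.top_toSubmodule, ← hx,
    Algebra.adjoin_eq_span, span_le]
  intro y hy
  obtain ⟨p, hp⟩ : ∃ p, y ∈ shortSpan K x n ^ p := by
    induction hy using Submonoid.closure_induction_right with
    | one => exact ⟨0, by rw [pow_zero]; exact one_le.1 le_rfl⟩
    | mul_right y _ _ hz ih =>
      obtain ⟨p, hp⟩ := ih
      obtain ⟨i, hi, rfl⟩ := hz
      exact ⟨p + 1, pow_succ (shortSpan K x n) p ▸ mul_mem_mul hp (self_mem_shortSpan hi)⟩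
  exact h.shortSpan_pow_le_ker hU hc hτ hS hb p
    (pow_le_pow_right' one_le_shortSpan (by omega : p ≤ 2 * p + 1) hp)

end IsTLCycle

namespace AffineTL

open Submodule

section
variable {K R : Type*} [CommRing K] [Ring R] [Algebra K R]

theorem tlV_swap {g h : R} (hgh : g * h * g = h * g * h) : tlV h g = tlV g h := by
  rw [tlV, tlV, hgh]; abel

theorem add_one_mul_self {q : K} {g : R} (hg : g * g = (q - 1) • g + algebraMap K R q) :
    (g + 1) * (g + 1) = (q + 1) • (g + 1) := by
  rw [Algebra.algebraMap_eq_smul_one] at hg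
  rw [add_mul, mul_add, hg, mul_one, one_mul]
  module

theorem add_one_mul_add_one_mul_add_one {q : K} {g h : R}
    (hg : g * g = (q - 1) • g + algebraMap K R q) (hV : tlV g h = 0) :
    (g + 1) * (h + 1) * (g + 1) = q • (g + 1) := by
  calc (g + 1) * (h + 1) * (g + 1) = tlV g h + g * g + g := by rw [tlV]; noncomm_ring
    _ = q • (g + 1) := by rw [hV, hg, Algebra.algebraMap_eq_smul_one]; module

theorem commute_add_one {g h : R} (hgh : Commute g h) : Commute (g + 1) (h + 1) :=
  (hgh.add_right (.one_right g)).add_left (.one_left _)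

theorem braidConj_add_one {q : Kˣ} {u : Rˣ} {g : R}
    (hu : (u : R) * u = ((q : K) - 1) • (u : R) + algebraMap K R q) (hV : tlV (u : R) g = 0) :
    braidConj q (u + 1 : R) (g + 1) = u * g * ↑u⁻¹ + 1 := by
  have hb := braidConj_mul (add_one_mul_self hu) (add_one_mul_add_one_mul_add_one hu hV)
  have hconj : braidConj q (u + 1 : R) (g + 1) * u = u * (g + 1) := by
    calc braidConj q (u + 1 : R) (g + 1) * u
        = braidConj q (u + 1 : R) (g + 1) * (u + 1) - braidConj q (u + 1 : R) (g + 1) := by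
          rw [mul_add_one, add_sub_cancel_right]
      _ = u * (g + 1) := by rw [hb, braidConj, add_mul (u : R), one_mul]; abel
  rw [← Units.mul_left_inj u, hconj, add_mul, Units.inv_mul_cancel_right, one_mul, mul_add_one]

/-- The shifted generators `g + 1` of the algebra of rank `n + 1`, arranged in a cycle: index `0`
carries `g_{aₙ₊₁} + 1`, and so do the irrelevant indices `i > n`. -/
def shiftedGen (q : K) {n : ℕ} (hn : 2 ≤ n) (i : ℕ) : AffineTL K q (n + 1) :=
  if h : 1 ≤ i ∧ i ≤ n then gSigma q i h.1 (by omega) + 1 else gA q (by omega) + 1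

variable {n i : ℕ}

theorem shiftedGen_of_le (q : K) (hn : 2 ≤ n) (h₁ : 1 ≤ i) (h₂ : i ≤ n) :
    shiftedGen q hn i = gSigma q i h₁ (by omega) + 1 :=
  dif_pos ⟨h₁, h₂⟩

theorem shiftedGen_zero (q : K) (hn : 2 ≤ n) :
    shiftedGen q hn 0 = gA q (n := n + 1) (by omega) + 1 :=
  dif_neg (by omega)

theorem shiftedGen_mul_self (q : K) (hn : 2 ≤ n) (i : ℕ) :
    shiftedGen q hn i * shiftedGen q hn i = (q + 1) • shiftedGen q hn i := by
  unfold shiftedGen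
  split_ifs <;> exact add_one_mul_self (gen_mul_self q _)

theorem shiftedGen_mul_mul_succ (q : K) (hn : 2 ≤ n) (h₁ : 1 ≤ i) (h₂ : i + 1 ≤ n) :
    shiftedGen q hn i * shiftedGen q hn (i + 1) * shiftedGen q hn i = q • shiftedGen q hn i ∧
      shiftedGen q hn (i + 1) * shiftedGen q hn i * shiftedGen q hn (i + 1) =
        q • shiftedGen q hn (i + 1) := by
  have hV := tlV_gSigma q (n := n + 1) i h₁ (by omega)
  rw [shiftedGen_of_le q hn h₁ (by omega), shiftedGen_of_le q hn (by omega) h₂]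
  exact ⟨add_one_mul_add_one_mul_add_one (gen_mul_self q _) hV,
    add_one_mul_add_one_mul_add_one (gen_mul_self q _)
      ((tlV_swap (gSigma_braid q i h₁ (by omega))).trans hV)⟩

theorem shiftedGen_mul_mul_zero (q : K) (hn : 2 ≤ n) (hi : i = 1 ∨ i = n) :
    shiftedGen q hn i * shiftedGen q hn 0 * shiftedGen q hn i = q • shiftedGen q hn i ∧
      shiftedGen q hn 0 * shiftedGen q hn i * shiftedGen q hn 0 = q • shiftedGen q hn 0 := by
  have hV := tlV_gSigma_gA q (n := n + 1) i (by omega) (by omega)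
  rw [shiftedGen_of_le q hn (by omega) (by omega), shiftedGen_zero]
  exact ⟨add_one_mul_add_one_mul_add_one (gen_mul_self q _) hV,
    add_one_mul_add_one_mul_add_one (gen_mul_self q _)
      ((tlV_swap (gSigma_gA_braid q i (by omega) (by omega))).trans hV)⟩

theorem commute_shiftedGen (q : K) (hn : 2 ≤ n) {i j : ℕ} (hij : i + 2 ≤ j) (hj : j ≤ n)
    (h : ¬(i = 0 ∧ j = n)) : Commute (shiftedGen q hn i) (shiftedGen q hn j) := by
  rcases Nat.eq_zero_or_pos i with rfl | hi
  · rw [shiftedGen_zero, shiftedGen_of_le q hn (by omega) hj]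
    exact commute_add_one (gSigma_gA_comm q j (by omega) (by omega)).symm
  · rw [shiftedGen_of_le q hn hi (by omega), shiftedGen_of_le q hn (by omega) hj]
    exact commute_add_one (gSigma_comm q i j _ _ _ _ (Or.inl hij))

theorem isTLCycle_shiftedGen (q : K) (hn : 2 ≤ n) :
    IsTLCycle (q + 1) q (shiftedGen q hn) n where
  two_le := hn
  mul_self i _ := shiftedGen_mul_self q hn i
  mul_mul i j hi hj hij := by
    rcases Nat.eq_zero_or_pos i with rfl | hi₀
    · exact (shiftedGen_mul_mul_zero q hn (by omega)).2
    rcases Nat.eq_zero_or_pos j with rfl | hj₀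
    · exact (shiftedGen_mul_mul_zero q hn (by omega)).1
    obtain rfl | rfl : j = i + 1 ∨ i = j + 1 := by omega
    · exact (shiftedGen_mul_mul_succ q hn hi₀ hj).1
    · exact (shiftedGen_mul_mul_succ q hn hj₀ hi).2
  commute _ _ := commute_shiftedGen q hn

theorem adjoin_shiftedGen (q : K) (hn : 2 ≤ n) :
    Algebra.adjoin K (shiftedGen q hn '' Set.Iic n) = ⊤ := by
  rw [eq_top_iff, ← (AlgHom.range_eq_top _).2 (RingQuot.mkAlgHom_surjective K (AffRel K q (n + 1))),
    ← Algebra.map_top, ← FreeAlgebra.adjoin_range_ι, AlgHom.map_adjoin]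
  have hmem {j} (hj : j ≤ n) : shiftedGen q hn j - 1 ∈
      Algebra.adjoin K (shiftedGen q hn '' Set.Iic n) :=
    sub_mem (Algebra.subset_adjoin ⟨j, hj, rfl⟩) (one_mem _)
  refine Algebra.adjoin_le ?_
  rintro _ ⟨_, ⟨s | _, rfl⟩, rfl⟩
  · have := hmem (j := s) (by omega)
    rwa [shiftedGen_of_le q hn (by omega) (by omega), add_sub_cancel_right] at this
  · have := hmem n.zero_le
    rwa [shiftedGen_zero, add_sub_cancel_right] at this

theorem wordAlg_shiftedGen_le_range (q : Kˣ) (hn : 2 ≤ n) :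
    wordAlg K (shiftedGen (q : K) hn) 1 n ≤ (F q n).range := by
  refine Algebra.adjoin_le ?_
  rintro _ ⟨i, ⟨h₁, h₂⟩, rfl⟩
  rw [shiftedGen_of_le _ hn h₁ h₂.le]
  exact add_mem ⟨_, F_gen q n (.sigma i h₁ h₂)⟩ (one_mem _)

theorem braidConj_shiftedGen_mem_range (q : Kˣ) (hn : 2 ≤ n) :
    braidConj q (shiftedGen (q : K) hn n) (shiftedGen (q : K) hn 0) ∈ (F q n).range := by
  have hconj := braidConj_add_one (u := uSigma q n (by omega) le_rfl) (gen_mul_self (q : K) _)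
    (tlV_gSigma_gA (q : K) n (by omega) (Or.inr rfl))
  rw [shiftedGen_of_le _ hn (by omega) le_rfl, shiftedGen_zero, ← val_uSigma, hconj,
    ← towerGen_a q hn]
  exact add_mem ⟨_, F_gen q n (.a hn)⟩ (one_mem _)

variable {M : Type*} [AddCommGroup M] [Module K M] {q : Kˣ}
  {τ : AffineTL K (q : K) (n + 1) →ₗ[K] M}

theorem range_le_ker (hn : 2 ≤ n) (hτ : ∀ x, IsMarkov q hn x → τ x = 0) :
    (F q n).range.toSubmodule ≤ LinearMap.ker τ := fun x hx ↦
  hτ x ⟨x, hx, 1, one_mem _, 0, Or.inl rfl, by simp⟩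

theorem bispan_range_le_ker (hn : 2 ≤ n) (hτ : ∀ x, IsMarkov q hn x → τ x = 0) :
    bispan (F q n).range (shiftedGen (q : K) hn n) ≤ LinearMap.ker τ := by
  refine bispan_le_of_forall_mul_mem fun a ha b hb ↦ ?_
  rw [shiftedGen_of_le _ hn (by omega) le_rfl, mul_add_one, add_mul]
  exact add_mem (hτ _ ⟨a, ha, b, hb, 1, Or.inr rfl, by rw [pow_one]⟩)
    (range_le_ker hn hτ ((F q n).range.mul_mem ha hb))

end

end AffineTL

theorem mainTheorem2_general {K M : Type*} [CommRing K] [AddCommGroup M] [Module K M]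
    (q : Kˣ) (n : ℕ) (hn : 2 ≤ n) (τ τ' : AffineTL K (q : K) (n + 1) →ₗ[K] M)
    (hτ : ∀ x y, τ (x * y) = τ (y * x)) (hτ' : ∀ x y, τ' (x * y) = τ' (y * x))
    (h : ∀ x : AffineTL K (q : K) (n + 1), AffineTL.IsMarkov q hn x → τ x = τ' x) :
    τ = τ' := by
  have hcomm (x y) : (τ - τ') (x * y) = (τ - τ') (y * x) := by
    simp only [LinearMap.sub_apply, hτ x y, hτ' x y]
  have hmarkov (x) (hx : AffineTL.IsMarkov q hn x) : (τ - τ') x = 0 := sub_eq_zero.2 (h x hx)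
  exact sub_eq_zero.1 <| (AffineTL.isTLCycle_shiftedGen (q : K) hn).eq_zero_of_adjoin_eq_top
    (AffineTL.adjoin_shiftedGen (q : K) hn) (AffineTL.wordAlg_shiftedGen_le_range q hn)
    (AffineTL.braidConj_shiftedGen_mem_range q hn) hcomm (AffineTL.range_le_ker hn hmarkov)
    (AffineTL.bispan_range_le_ker hn hmarkov)

theorem mainTheorem2 {K : Type*} [CommRing K] [IsDomain K] [CharZero K]
    (q : Kˣ) (hsq : IsSquare (q : K)) (hq : IsUnit ((q : K) + 1))
    (n : ℕ) (hn : 2 ≤ n)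
    (τ τ' : AffineTL K (q : K) (n + 1) →ₗ[K] K)
    (hτ : IsTraceForm τ) (hτ' : IsTraceForm τ')
    (h : ∀ x : AffineTL K (q : K) (n + 1), AffineTL.IsMarkov q hn x → τ x = τ' x) :
    τ = τ' :=
  mainTheorem2_general q n hn τ τ' hτ hτ' h
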